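/- Let $R$ be a commutative ring and let $C$ be a semidualizing $R$-module, that is: $C$ has a (possibly unbounded) resolution by free $R$-modules of finite rank, the homothety map $R\to\operatorname{Hom}_R(C,C)$ is an isomorphism, and $\operatorname{Ext}^i_R(C,C)=0$ for all $i\ge 1$. Let $\mathcal I_C$ be the class of $R$-modules isomorphic to $\operatorname{Hom}_R(C,I)$ with $I$ an injective $R$-module. A complex $S$ of modules in $\mathcal I_C$ is totally $\mathcal I_C$-acyclic if it is exact and $\operatorname{Hom}_R(X,S)$ and $\operatorname{Hom}_R(S,X)$ are exact for every $X\in\mathcal I_C$; let $\mathcal G(\mathcal I_C)$ be the class of modules isomorphic to $\operatorname{Coker}(S^{-1}\to S^0)$ for such an $S$. For a class $\mathcal Y$ of modules, a $\mathcal Y$-coresolution of $N$ is an exact sequence $0\to N\to Y^0\to Y^1\to\cdots$ with all $Y^n\in\mathcal Y$; it is proper if it stays exact under $\operatorname{Hom}_R(-,X)$ for every $X\in\mathcal Y$; and $\mathcal Y\text{-}\mathrm{id}_R(N)$ is the infimum of $\sup\{n\ge 0: Y^n\ne 0\}$ over all $\mathcal Y$-coresolutions of $N$. A Tate $\mathcal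 I_C$-coresolution of $N$ is a diagram $N\to Y\xrightarrow{\beta}S$ in which $N\to Y$ is a proper $\mathcal I_C$-coresolution, $S$ is totally $\mathcal I_C$-acyclic, and $\beta$ is a morphism of complexes with $\beta^n$ an isomorphism for all $n\gg 0$. If $N$ admits one, put $\widehat{\operatorname{Ext}}^n_{\mathcal I_C}(L,N)=H^n(\operatorname{Hom}_R(L,S))$ for every $R$-module $L$ and every $n\in\mathbb Z$. Let $M$ be an $R$-module with $\mathcal G(\mathcal I_C)\text{-}\mathrm{id}_R(M)<\infty$. Then $M$ admits a Tate $\mathcal I_C$-coresolution, and the following conditions are equivalent: (i) $\mathcal I_C\text{-}\mathrm{id}_R(M)<\infty$; (ii) $\widehat{\operatorname{Ext}}^n_{\mathcal I_C}(M,-)=0$ on the modules that admit a Tate $\mathcal I_C$-coresolution, for each (equivalently, for some) $n\in\mathbb Z$; (iii) $\widehat{\operatorname{Ext}}^n_{\mathcal I_C}(-,M)=0$ on all $R$-modules, for each (equivalently, for some) $n\in\mathbb Z$; (iv) $\widehat{\operatorname{Ext}}^0_{\mathcal I_C}(M,M)=0$. -/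

import Mathlib

open CategoryTheory CategoryTheory.Limits

universe v u

namespace RelativeTate

section Abelian

variable {A : Type u} [Category.{v} A] [Abelian A]

/-- The complex `Hom(X, K)`. -/
noncomputable def homFrom {ι : Type*} {c : ComplexShape ι} (X : A) (K : HomologicalComplex A c) :
    HomologicalComplex AddCommGrpCat.{v} c :=
  ((preadditiveCoyoneda.obj (Opposite.op X)).mapHomologicalComplex c).obj K

/-- The complex `Hom(K, X)`. -/
noncomputable def homTo {ι : Type*} {c : ComplexShape ι} (K : HomologicalComplex A c) (X : A) :
    HomologicalComplex AddCommGrpCat.{v} c.symm :=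
  ((preadditiveYoneda.obj X).mapHomologicalComplex c.symm).obj K.op

/-- `K` is `Hom(𝒱, -)`-exact. -/
def IsHomFromExact {ι : Type*} {c : ComplexShape ι} (V : ObjectProperty A)
    (K : HomologicalComplex A c) : Prop :=
  ∀ X : A, V X → (homFrom X K).Acyclic

/-- `K` is `Hom(-, 𝒱)`-exact. -/
def IsHomToExact {ι : Type*} {c : ComplexShape ι} (V : ObjectProperty A)
    (K : HomologicalComplex A c) : Prop :=
  ∀ X : A, V X → (homTo K X).Acyclic

/-- A totally `𝒱`-acyclic complex: an exact complex of objects of `𝒱` that is both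
`Hom(𝒱, -)`-exact and `Hom(-, 𝒱)`-exact. All complexes are written cohomologically: the term that
is in degree `n` here is the one in homological degree `-n`. -/
structure IsTotallyAcyclic (V : ObjectProperty A) (S : CochainComplex A ℤ) : Prop where
  mem : ∀ n, V (S.X n)
  exact : S.Acyclic
  homFrom_exact : IsHomFromExact V S
  homTo_exact : IsHomToExact V S

/-- The class `𝒢(𝒱)` of the objects isomorphic to `Coker (S⁻¹ ⟶ S⁰)` for some totally
`𝒱`-acyclic complex `S`. -/
def gorenstein (V : ObjectProperty A) : ObjectProperty A := fun M =>
  ∃ S : CochainComplex A ℤ, IsTotallyAcyclic V S ∧ Nonempty (M ≅ cokernel (S.d (-1) 0))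

/-- A `𝒱`-coresolution `0 ⟶ N ⟶ Y⁰ ⟶ Y¹ ⟶ ⋯` of `N`. -/
structure Coresolution (V : ObjectProperty A) (N : A) where
  /-- the complex `Y` -/
  complex : CochainComplex A ℕ
  /-- the coaugmentation `N ⟶ Y⁰` -/
  ι : N ⟶ complex.X 0
  ι_d : ι ≫ complex.d 0 1 = 0
  mem : ∀ n, V (complex.X n)
  exact : (complex.augment ι ι_d).Acyclic

/-- The augmented coresolution `0 ⟶ N ⟶ Y⁰ ⟶ Y¹ ⟶ ⋯`, with `N` placed in degree `0`. -/
noncomputable def Coresolution.augmented {V : ObjectProperty A} {N : A} (Y : Coresolution V N) :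
    CochainComplex A ℕ :=
  Y.complex.augment Y.ι Y.ι_d

/-- A `𝒱`-coresolution is proper if the augmented coresolution is `Hom(-, 𝒱)`-exact. -/
def Coresolution.IsProper {V : ObjectProperty A} {N : A} (Y : Coresolution V N) : Prop :=
  IsHomToExact V Y.augmented

/-- The length `sup {n | Yⁿ ≠ 0}` of a coresolution. -/
noncomputable def Coresolution.length {V : ObjectProperty A} {N : A} (Y : Coresolution V N) : ℕ∞ :=
  ⨆ (n : ℕ) (_ : ¬ IsZero (Y.complex.X n)), (n : ℕ∞)

/-- The `𝒱`-injective dimension of `N`: the infimum of the lengths of its `𝒱`-coresolutions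
(so it is `⊤` if there is none). -/
noncomputable def injDim (V : ObjectProperty A) (N : A) : ℕ∞ :=
  ⨅ Y : Coresolution V N, Y.length

/-- A Tate `𝒱`-coresolution `N ⟶ Y ⟶ S` of `N`: a proper `𝒱`-coresolution `Y` of `N` (regarded as
a complex indexed by `ℤ` that vanishes in negative degrees), a totally `𝒱`-acyclic complex `S`, and
a morphism of complexes `β : Y ⟶ S` that is an isomorphism in all large cohomological degrees. -/
structure TateCoresolution (V : ObjectProperty A) (N : A) where
  Y : Coresolution V N
  proper : Y.IsProper
  S : CochainComplex A ℤ
  totallyAcyclic : IsTotallyAcyclic V S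
  β : Y.complex.extend ComplexShape.embeddingUpNat ⟶ S
  isIso_β : ∃ n₀ : ℤ, ∀ n, n₀ ≤ n → IsIso (β.f n)

/-- `N` admits a Tate `𝒱`-coresolution. -/
def HasTateCoresolution (V : ObjectProperty A) (N : A) : Prop :=
  Nonempty (TateCoresolution V N)

/-- The Tate cohomology group of `(M, N)` in degree `n`, the cohomology `Hⁿ(Hom(M, S))` for a
Tate `𝒱`-coresolution `N ⟶ Y ⟶ S`. It is defined for every `M` and for every `N` that admits a
Tate `𝒱`-coresolution. -/
noncomputable def tateExt (V : ObjectProperty A) (n : ℤ) (M N : A)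
    (hN : HasTateCoresolution V N) : AddCommGrpCat.{v} :=
  (homFrom M (Classical.choice hN).S).homology n

end Abelian

section Modules

variable {R : Type u} [CommRing R]

/-- Semidualizing modules. -/
structure IsSemidualizing (C : ModuleCat.{u} R) : Prop where
  /-- `C` has a (possibly unbounded) resolution by free modules of finite rank. -/
  exists_resolution : ∃ (P : ChainComplex (ModuleCat.{u} R) ℕ) (π : P.X 0 ⟶ C)
    (w : P.d 1 0 ≫ π = 0), (∀ n, Module.Free R (P.X n) ∧ Module.Finite R (P.X n)) ∧
      (P.augment π w).Acyclic
  /-- The homothety map `R → Hom(C, C)` is an isomorphism. -/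
  homothety_bijective : Function.Bijective (LinearMap.lsmul R C)
  ext_eq_zero : ∀ n : ℕ, 1 ≤ n → Subsingleton (Abelian.Ext C C n)

/-- The class `ℐ_C(R)` of the `C`-injective modules, those isomorphic to `Hom(C, I)` for some
injective module `I`. -/
def cInjective (C : ModuleCat.{u} R) : ObjectProperty (ModuleCat.{u} R) := fun N =>
  ∃ I : ModuleCat.{u} R, Injective I ∧ Nonempty (N ≅ ModuleCat.of R (C →ₗ[R] I))

end Modules

end RelativeTate

-- All but the last part of the argument works for a class `V` in an abelian category that contains
-- the zero objects, is closed under finite sums and retracts, and has no positive self-extensions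
-- (`IsSelfOrthogonal`).
--
-- Existence. Dimension shifting shows that cycles of totally `V`-acyclic complexes are
-- Ext-orthogonal to `V` on both sides. Conversely, splicing short exact sequences with middle term
-- in `V` inside a two-sided orthogonal class gives totally acyclic complexes
-- (`isTateCycle_of_coinduction`). With the horseshoe lemma, such cycles are closed under
-- extensions, so a finite `𝒢(V)`-coresolution of `M` can be replaced by `0 → M → X⁰ → ⋯ → Xᵈ⁻¹ → G
-- → 0` with `Xⁱ` in `V` and `G` a cycle. A totally acyclic complex through `G`, truncated at `G`
-- and prolonged to the left by the `Xⁱ`, gives the Tate coresolution.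
--
-- Vanishing. Work modulo the morphisms that factor through `V`. `Hⁿ(Hom(L, S))` vanishes iff every
-- `L → Zⁿ(S)` factors through `V` (`IsTotallyAcyclic.isZero_homology_iff`), and such factorizations
-- move up and down along morphisms of short exact sequences (`FactorsThrough.τ₃`,
-- `FactorsThrough.τ₁`). If `M` has finite `V`-injective dimension, Ext-vanishing makes the
-- identities of the `Zⁿ(S)` factor through `V`. Conversely, such a factorization puts `Zⁿ(Y) ≅
-- Zⁿ(S)` in `V` for large `n`, where `Y` can be truncated. If degree-zero Tate cohomology of `(M,
-- M)` vanishes, then `M → Z⁰(S)` factors through `V`; climbing the ladder `Y → S` to a degree where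
-- the comparison is an isomorphism gives such a factorization.
--
-- Semidualizing input. For `I` injective, evaluation gives `C ⊗ Hom(C, I) ≅ Hom(Hom(C, C), I) ≅ I`,
-- and `Extⁱ(C, C) = 0` dualizes to `Torᵢ(C, Hom(C, I)) = 0`. Hence `Extⁱ(Hom(C, I), Hom(C, J)) ≅
-- Hom(Torᵢ(C, Hom(C, I)), J) = 0` for `i ≥ 1`, and a retract `Z` of `Hom(C, I)` is `Hom(C, C ⊗ Z)`
-- with `C ⊗ Z` injective.

universe w v₁ u₁

set_option linter.unusedSectionVars false

namespace RelativeTate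

section Abelian

variable {A : Type u₁} [Category.{v₁} A] [Abelian A]

/-! ### Short exact sequences and the snake lemma. -/

section ShortExact

/-- There is a short exact sequence `0 ⟶ X₁ ⟶ X₂ ⟶ X₃ ⟶ 0`. -/
def IsExtension (X₁ X₂ X₃ : A) : Prop :=
  ∃ (f : X₁ ⟶ X₂) (g : X₂ ⟶ X₃) (w : f ≫ g = 0), (ShortComplex.mk f g w).ShortExact

lemma IsExtension.of_shortExact {S : ShortComplex A} (hS : S.ShortExact) :
    IsExtension S.X₁ S.X₂ S.X₃ :=
  ⟨S.f, S.g, S.zero, hS⟩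

lemma IsExtension.of_iso {X₁ X₂ X₃ Y₁ Y₃ : A} (h : IsExtension X₁ X₂ X₃) (e₁ : X₁ ≅ Y₁)
    (e₃ : X₃ ≅ Y₃) : IsExtension Y₁ X₂ Y₃ := by
  obtain ⟨f, g, w, h⟩ := h
  refine ⟨e₁.inv ≫ f, g ≫ e₃.hom, by simp [reassoc_of% w], ShortComplex.shortExact_of_iso ?_ h⟩
  exact ShortComplex.isoMk e₁ (Iso.refl _) e₃ (by simp) (by simp)

lemma isExtension_kernel {X Y : A} (f : X ⟶ Y) [Epi f] : IsExtension (kernel f) X Y :=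
  ⟨kernel.ι f, f, kernel.condition f,
    { exact := ShortComplex.exact_of_f_is_kernel _ (kernelIsKernel f) }⟩

lemma isExtension_id (X : A) {Z : A} (hZ : IsZero Z) : IsExtension X X Z :=
  ⟨𝟙 X, 0, comp_zero,
    { exact := (ShortComplex.exact_iff_epi _ rfl).2 (inferInstanceAs (Epi (𝟙 X)))
      mono_f := inferInstanceAs (Mono (𝟙 X))
      epi_g := ⟨fun _ _ _ => hZ.eq_of_src _ _⟩ }⟩

/-- The snake input attached to a morphism of short exact sequences. -/
noncomputable def snakeInput {S T : ShortComplex A} (hS : S.ShortExact) (hT : T.ShortExact)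
    (φ : S ⟶ T) : ShortComplex.SnakeInput A where
  L₀ := kernel φ
  L₁ := S
  L₂ := T
  L₃ := cokernel φ
  v₀₁ := kernel.ι φ
  v₁₂ := φ
  v₂₃ := cokernel.π φ
  w₀₂ := kernel.condition φ
  w₁₃ := cokernel.condition φ
  h₀ := kernelIsKernel φ
  h₃ := cokernelIsCokernel φ
  L₁_exact := hS.exact
  epi_L₁_g := hS.epi_g
  L₂_exact := hT.exact
  mono_L₂_f := hT.mono_f

/-- The cokernels of a monomorphism of short exact sequences form a short exact sequence. -/
lemma exists_cokernel_extension {S T : ShortComplex A} (hS : S.ShortExact) (hT : T.ShortExact)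
    (φ : S ⟶ T) {C₁ C₃ : A} {c₁ : T.X₁ ⟶ C₁} {c₃ : T.X₃ ⟶ C₃} {w₁ : φ.τ₁ ≫ c₁ = 0}
    {w₃ : φ.τ₃ ≫ c₃ = 0} (h₁ : (ShortComplex.mk _ _ w₁).ShortExact)
    (h₃ : (ShortComplex.mk _ _ w₃).ShortExact) :
    ∃ Q : A, IsExtension S.X₂ T.X₂ Q ∧ IsExtension C₁ Q C₃ := by
  let D := snakeInput hS hT φ
  have m₁ : Mono φ.τ₁ := h₁.mono_f
  have m₃ : Mono φ.τ₃ := h₃.mono_f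
  have m₂ : Mono φ.τ₂ := by
    have := hT.mono_f
    have := hS.mono_f
    exact ShortComplex.mono_τ₂_of_exact_of_mono φ hS.exact
  have e := hT.epi_g
  have e' : Epi D.L₂.g := e
  have z : IsZero D.L₀.X₃ := by
    have : Mono D.v₁₂.τ₃ := m₃
    have : D.v₀₁.τ₃ = 0 := by rw [← cancel_mono D.v₁₂.τ₃]; simp
    exact IsZero.of_mono_eq_zero _ this
  have mf : Mono D.L₃.f :=
    (ShortComplex.exact_iff_mono _ (z.eq_of_src _ _)).1 D.L₂'_exact
  have hL : D.L₃.ShortExact := { exact := D.L₃_exact, mono_f := mf, epi_g := D.epi_L₃_g }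
  refine ⟨D.L₃.X₂, ⟨φ.τ₂, D.v₂₃.τ₂, D.w₁₃_τ₂, ?_⟩,
    (IsExtension.of_shortExact hL).of_iso ?_ ?_⟩
  · exact { exact := ShortComplex.exact_of_g_is_cokernel _ D.h₃τ₂
            epi_g := epi_of_isColimit_cofork D.h₃τ₂ }
  · exact D.h₃τ₁.coconePointUniqueUpToIso h₁.gIsCokernel
  · exact D.h₃τ₃.coconePointUniqueUpToIso h₃.gIsCokernel

/-- The kernels of an epimorphism of short exact sequences form a short exact sequence. -/
lemma exists_kernel_extension {S T : ShortComplex A} (hS : S.ShortExact) (hT : T.ShortExact)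
    (φ : S ⟶ T) {K₁ K₃ : A} {k₁ : K₁ ⟶ S.X₁} {k₃ : K₃ ⟶ S.X₃} {w₁ : k₁ ≫ φ.τ₁ = 0}
    {w₃ : k₃ ≫ φ.τ₃ = 0} (h₁ : (ShortComplex.mk _ _ w₁).ShortExact)
    (h₃ : (ShortComplex.mk _ _ w₃).ShortExact) :
    ∃ Q : A, IsExtension Q S.X₂ T.X₂ ∧ IsExtension K₁ Q K₃ := by
  let D := snakeInput hS hT φ
  have m₁ : Epi φ.τ₁ := h₁.epi_g
  have m₃ : Epi φ.τ₃ := h₃.epi_g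
  have m₂ : Epi φ.τ₂ := by
    have := hS.epi_g
    have := hT.epi_g
    exact ShortComplex.epi_τ₂_of_exact_of_epi φ hT.exact
  have e := hS.mono_f
  have e' : Mono D.L₁.f := e
  have z : IsZero D.L₃.X₁ := by
    have : Epi D.v₁₂.τ₁ := m₁
    have : D.v₂₃.τ₁ = 0 := by rw [← cancel_epi D.v₁₂.τ₁]; simp
    exact IsZero.of_epi_eq_zero _ this
  have mf : Epi D.L₀.g :=
    (ShortComplex.exact_iff_epi _ (z.eq_of_tgt _ _)).1 D.L₁'_exact
  have hL : D.L₀.ShortExact := { exact := D.L₀_exact, mono_f := D.mono_L₀_f, epi_g := mf }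
  refine ⟨D.L₀.X₂, ⟨D.v₀₁.τ₂, φ.τ₂, D.w₀₂_τ₂, ?_⟩,
    (IsExtension.of_shortExact hL).of_iso ?_ ?_⟩
  · exact { exact := ShortComplex.exact_of_f_is_kernel _ D.h₀τ₂
            mono_f := mono_of_isLimit_fork D.h₀τ₂ }
  · exact D.h₀τ₁.conePointUniqueUpToIso h₁.fIsKernel
  · exact D.h₀τ₃.conePointUniqueUpToIso h₃.fIsKernel

end ShortExact

/-! ### Vanishing of Ext along short exact sequences. -/

section Ext

variable [HasExt.{w} A] {S : ShortComplex A} (hS : S.ShortExact) (Y : A)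

open Abelian

include hS

lemma subsingleton_ext_X₂_left {n : ℕ} [Subsingleton (Ext.{w} S.X₁ Y n)]
    [Subsingleton (Ext.{w} S.X₃ Y n)] : Subsingleton (Ext.{w} S.X₂ Y n) := by
  refine subsingleton_of_forall_eq 0 fun x => ?_
  obtain ⟨y, rfl⟩ := Ext.contravariant_sequence_exact₂ hS Y x (Subsingleton.elim _ _)
  rw [Subsingleton.elim y 0, Ext.comp_zero]

lemma subsingleton_ext_X₁_left {n m : ℕ} (h : 1 + n = m) [Subsingleton (Ext.{w} S.X₂ Y n)]
    [Subsingleton (Ext.{w} S.X₃ Y m)] : Subsingleton (Ext.{w} S.X₁ Y n) := by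
  refine subsingleton_of_forall_eq 0 fun x => ?_
  obtain ⟨y, rfl⟩ := Ext.contravariant_sequence_exact₁ hS Y x h (Subsingleton.elim _ _)
  rw [Subsingleton.elim y 0, Ext.comp_zero]

lemma subsingleton_ext_X₃_left {n m : ℕ} (h : 1 + n = m) [Subsingleton (Ext.{w} S.X₁ Y n)]
    [Subsingleton (Ext.{w} S.X₂ Y m)] : Subsingleton (Ext.{w} S.X₃ Y m) := by
  refine subsingleton_of_forall_eq 0 fun x => ?_
  obtain ⟨y, rfl⟩ := Ext.contravariant_sequence_exact₃ hS Y x (Subsingleton.elim _ _) h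
  rw [Subsingleton.elim y 0, Ext.comp_zero]

lemma subsingleton_ext_X₂_right {n : ℕ} [Subsingleton (Ext.{w} Y S.X₁ n)]
    [Subsingleton (Ext.{w} Y S.X₃ n)] : Subsingleton (Ext.{w} Y S.X₂ n) := by
  refine subsingleton_of_forall_eq 0 fun x => ?_
  obtain ⟨y, rfl⟩ := Ext.covariant_sequence_exact₂ Y hS x (Subsingleton.elim _ _)
  rw [Subsingleton.elim y 0, Ext.zero_comp]

lemma subsingleton_ext_X₁_right {n m : ℕ} (h : n + 1 = m) [Subsingleton (Ext.{w} Y S.X₂ m)]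
    [Subsingleton (Ext.{w} Y S.X₃ n)] : Subsingleton (Ext.{w} Y S.X₁ m) := by
  refine subsingleton_of_forall_eq 0 fun x => ?_
  obtain ⟨y, rfl⟩ := Ext.covariant_sequence_exact₁ Y hS x (Subsingleton.elim _ _) h
  rw [Subsingleton.elim y 0, Ext.zero_comp]

lemma subsingleton_ext_X₃_right {n m : ℕ} (h : n + 1 = m) [Subsingleton (Ext.{w} Y S.X₁ m)]
    [Subsingleton (Ext.{w} Y S.X₂ n)] : Subsingleton (Ext.{w} Y S.X₃ n) := by
  refine subsingleton_of_forall_eq 0 fun x => ?_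
  obtain ⟨y, rfl⟩ := Ext.covariant_sequence_exact₃ Y hS x h (Subsingleton.elim _ _)
  rw [Subsingleton.elim y 0, Ext.zero_comp]

variable {Y}

lemma exists_extension_of_subsingleton_ext [Subsingleton (Ext.{w} S.X₃ Y 1)] (f : S.X₁ ⟶ Y) :
    ∃ g : S.X₂ ⟶ Y, S.f ≫ g = f := by
  obtain ⟨y, hy⟩ := Ext.contravariant_sequence_exact₁ hS Y (Ext.mk₀ f) (add_zero 1)
    (Subsingleton.elim _ _)
  obtain ⟨g, rfl⟩ := (Ext.mk₀_bijective _ _).2 y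
  refine ⟨g, (Ext.mk₀_bijective _ _).1 ?_⟩
  rw [← hy, Ext.mk₀_comp_mk₀]

lemma exists_lift_of_subsingleton_ext [Subsingleton (Ext.{w} Y S.X₁ 1)] (f : Y ⟶ S.X₃) :
    ∃ g : Y ⟶ S.X₂, g ≫ S.g = f := by
  obtain ⟨y, hy⟩ := Ext.covariant_sequence_exact₃ Y hS (Ext.mk₀ f) (zero_add 1)
    (Subsingleton.elim _ _)
  obtain ⟨g, rfl⟩ := (Ext.mk₀_bijective _ _).2 y
  refine ⟨g, (Ext.mk₀_bijective _ _).1 ?_⟩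
  rw [← hy, Ext.mk₀_comp_mk₀]

/-- Every class in `Ext¹(S.X₃, Y)` is the connecting image of some `S.X₁ ⟶ Y`, and this image
vanishes as soon as the morphism extends to `S.X₂`. This turns Hom-exactness of a complex into
Ext-vanishing on its cycles. -/
lemma subsingleton_ext_one_of_exists_extension [Subsingleton (Ext.{w} S.X₂ Y 1)]
    (h : ∀ f : S.X₁ ⟶ Y, ∃ g : S.X₂ ⟶ Y, S.f ≫ g = f) : Subsingleton (Ext.{w} S.X₃ Y 1) := by
  refine subsingleton_of_forall_eq 0 fun x => ?_
  obtain ⟨y, rfl⟩ := Ext.contravariant_sequence_exact₃ hS Y x (Subsingleton.elim _ _) (add_zero 1)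
  obtain ⟨f, rfl⟩ := (Ext.mk₀_bijective _ _).2 y
  obtain ⟨g, rfl⟩ := h f
  rw [← Ext.mk₀_comp_mk₀, ShortComplex.ShortExact.extClass_comp_assoc]

lemma subsingleton_ext_one_of_exists_lift [Subsingleton (Ext.{w} Y S.X₂ 1)]
    (h : ∀ f : Y ⟶ S.X₃, ∃ g : Y ⟶ S.X₂, g ≫ S.g = f) : Subsingleton (Ext.{w} Y S.X₁ 1) := by
  refine subsingleton_of_forall_eq 0 fun x => ?_
  obtain ⟨y, rfl⟩ := Ext.covariant_sequence_exact₁ Y hS x (Subsingleton.elim _ _) (zero_add 1)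
  obtain ⟨f, rfl⟩ := (Ext.mk₀_bijective _ _).2 y
  obtain ⟨g, rfl⟩ := h f
  rw [← Ext.mk₀_comp_mk₀, Ext.comp_assoc_of_second_deg_zero, ShortComplex.ShortExact.comp_extClass,
    Ext.comp_zero]

end Ext

/-! ### Self-orthogonal classes and their orthogonals. -/

section Perp

variable [HasExt.{w} A] (V : ObjectProperty A)

open Abelian

/-- A self-orthogonal additive class of objects: it contains the zero objects, is closed
under finite direct sums and direct summands, and `Extⁱ(X, Y) = 0` for `i ≥ 1` and `X`, `Y` in the
class. -/
class IsSelfOrthogonal : Prop where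
  zero (X : A) : IsZero X → V X
  biprod (X Y : A) : V X → V Y → V (X ⊞ Y)
  retract {X Y : A} (i : X ⟶ Y) (p : Y ⟶ X) : i ≫ p = 𝟙 X → V Y → V X
  ext (X Y : A) : V X → V Y → ∀ i : ℕ, Subsingleton (Ext.{w} X Y (i + 1))

variable {V} in
lemma IsSelfOrthogonal.of_iso [IsSelfOrthogonal.{w} V] {X Y : A} (e : X ≅ Y) (hX : V X) : V Y :=
  IsSelfOrthogonal.retract.{w} e.inv e.hom e.inv_hom_id hX

/-- The objects `N` with `Extⁱ(N, X) = 0` for all `i ≥ 1` and all `X` in `V`. -/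
def leftPerp : ObjectProperty A := fun N => ∀ X, V X → ∀ i : ℕ, Subsingleton (Ext.{w} N X (i + 1))

/-- The objects `N` with `Extⁱ(X, N) = 0` for all `i ≥ 1` and all `X` in `V`. -/
def rightPerp : ObjectProperty A := fun N => ∀ X, V X → ∀ i : ℕ, Subsingleton (Ext.{w} X N (i + 1))

variable {V}

lemma IsSelfOrthogonal.leftPerp [IsSelfOrthogonal.{w} V] {X : A} (hX : V X) :
    leftPerp.{w} V X := fun Y hY => IsSelfOrthogonal.ext X Y hX hY

lemma IsSelfOrthogonal.rightPerp [IsSelfOrthogonal.{w} V] {X : A} (hX : V X) :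
    rightPerp.{w} V X := fun Y hY => IsSelfOrthogonal.ext Y X hY hX

lemma leftPerp.of_extension {X₁ X₂ X₃ : A} (h : IsExtension X₁ X₂ X₃) (h₁ : leftPerp.{w} V X₁)
    (h₃ : leftPerp.{w} V X₃) : leftPerp.{w} V X₂ := fun X hX i => by
  obtain ⟨f, g, w, h⟩ := h
  have := h₁ X hX i
  have := h₃ X hX i
  exact subsingleton_ext_X₂_left h X

lemma leftPerp.of_left {X₁ X₂ X₃ : A} (h : IsExtension X₁ X₂ X₃) (h₂ : leftPerp.{w} V X₂)
    (h₃ : leftPerp.{w} V X₃) : leftPerp.{w} V X₁ := fun X hX i => by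
  obtain ⟨f, g, w, h⟩ := h
  have := h₂ X hX i
  have := h₃ X hX (i + 1)
  exact subsingleton_ext_X₁_left h X (Nat.add_comm 1 (i + 1))

lemma rightPerp.of_extension {X₁ X₂ X₃ : A} (h : IsExtension X₁ X₂ X₃) (h₁ : rightPerp.{w} V X₁)
    (h₃ : rightPerp.{w} V X₃) : rightPerp.{w} V X₂ := fun X hX i => by
  obtain ⟨f, g, w, h⟩ := h
  have := h₁ X hX i
  have := h₃ X hX i
  exact subsingleton_ext_X₂_right h X

lemma leftPerp.of_iso {X Y : A} (e : X ≅ Y) (h : leftPerp.{w} V X) : leftPerp.{w} V Y :=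
  fun W hW i => by
    have := h W hW i
    refine subsingleton_of_forall_eq 0 fun x => ?_
    rw [← Ext.mk₀_id_comp x, ← e.inv_hom_id, ← Ext.mk₀_comp_mk₀_assoc,
      Subsingleton.elim ((Ext.mk₀ e.hom).comp x _) 0, Ext.comp_zero]

lemma rightPerp.of_iso {X Y : A} (e : X ≅ Y) (h : rightPerp.{w} V X) : rightPerp.{w} V Y :=
  fun W hW i => by
    have := h W hW i
    refine subsingleton_of_forall_eq 0 fun x => ?_
    rw [← Ext.comp_mk₀_id x, ← e.inv_hom_id, ← Ext.mk₀_comp_mk₀,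
      ← Ext.comp_assoc_of_third_deg_zero, Subsingleton.elim (x.comp (Ext.mk₀ e.inv) _) 0,
      Ext.zero_comp]

end Perp

/-! ### Morphisms modulo those factoring through `V`. -/

section Stable

variable (V : ObjectProperty A)

/-- The morphism `f` factors through an object of `V`. -/
def FactorsThrough {X Y : A} (f : X ⟶ Y) : Prop :=
  ∃ (W : A) (a : X ⟶ W) (b : W ⟶ Y), V W ∧ a ≫ b = f

/-- Every morphism from the source of `f` to an object of `V` extends along `f`. -/
def ExtendsAlong {X Y : A} (f : X ⟶ Y) : Prop :=
  ∀ W, V W → ∀ a : X ⟶ W, ∃ u : Y ⟶ W, f ≫ u = a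

/-- Every morphism from an object of `V` to the target of `g` lifts along `g`. -/
def LiftsAlong {X Y : A} (g : X ⟶ Y) : Prop :=
  ∀ W, V W → ∀ b : W ⟶ Y, ∃ u : W ⟶ X, u ≫ g = b

/-- `X` is a retract of `Y` up to a morphism that factors through an object of `V`. -/
def IsStableRetract (X Y : A) : Prop :=
  ∃ (f : X ⟶ Y) (g : Y ⟶ X), FactorsThrough V (𝟙 X - f ≫ g)

variable {V}

lemma FactorsThrough.comp_left {X Y Z : A} {f : X ⟶ Y} (hf : FactorsThrough V f) (g : Z ⟶ X) :
    FactorsThrough V (g ≫ f) := by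
  obtain ⟨W, a, b, hW, rfl⟩ := hf
  exact ⟨W, g ≫ a, b, hW, by simp⟩

lemma FactorsThrough.comp_right {X Y Z : A} {f : X ⟶ Y} (hf : FactorsThrough V f) (g : Y ⟶ Z) :
    FactorsThrough V (f ≫ g) := by
  obtain ⟨W, a, b, hW, rfl⟩ := hf
  exact ⟨W, a, b ≫ g, hW, by simp⟩

/-- Write `φ.τ₁` as `a ≫ b` and extend `a` to `u` along `S.f`. Then `φ.τ₂ - u ≫ b ≫ T.f` kills
`S.f`, and the map `S.X₃ ⟶ T.X₂` that it induces, followed by `T.g`, is `φ.τ₃`. -/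
lemma FactorsThrough.τ₃ {S T : ShortComplex A} (hS : S.ShortExact) (φ : S ⟶ T) (hT : V T.X₂)
    (hext : ExtendsAlong V S.f)
    (h : FactorsThrough V φ.τ₁) : FactorsThrough V φ.τ₃ := by
  obtain ⟨W, a, b, hW, hab⟩ := h
  obtain ⟨u, rfl⟩ := hext W hW a
  have e := hS.epi_g
  have hk : S.f ≫ (φ.τ₂ - u ≫ b ≫ T.f) = 0 := by
    simp [Preadditive.comp_sub, ← φ.comm₁₂, ← hab]
  refine ⟨T.X₂, hS.exact.desc _ hk, T.g, hT, ?_⟩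
  rw [← cancel_epi S.g, hS.exact.g_desc_assoc]
  simp [Preadditive.sub_comp, φ.comm₂₃]

lemma FactorsThrough.τ₁ {S T : ShortComplex A} (hT : T.ShortExact) (φ : S ⟶ T) (hS : V S.X₂)
    (hlift : LiftsAlong V T.g)
    (h : FactorsThrough V φ.τ₃) : FactorsThrough V φ.τ₁ := by
  obtain ⟨W, a, b, hW, hab⟩ := h
  obtain ⟨u, rfl⟩ := hlift W hW b
  have e := hT.mono_f
  have hk : (φ.τ₂ - S.g ≫ a ≫ u) ≫ T.g = 0 := by
    simp [Preadditive.sub_comp, φ.comm₂₃, ← hab]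
  refine ⟨S.X₂, S.f, hT.exact.lift _ hk, hS, ?_⟩
  rw [← cancel_mono T.f, Category.assoc, hT.exact.lift_f]
  simp [Preadditive.comp_sub, φ.comm₁₂]

lemma IsStableRetract.of_iso_right {X Y Y' : A} (h : IsStableRetract V X Y) (e : Y ≅ Y') :
    IsStableRetract V X Y' := by
  obtain ⟨f, g, h⟩ := h
  exact ⟨f ≫ e.hom, e.inv ≫ g, by simpa using h⟩

/-- The maps on left ends extend to morphisms `φ`, `ψ` of short exact sequences; `FactorsThrough.τ₃`
then applies to `𝟙 S - φ ≫ ψ`. -/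
lemma IsStableRetract.up {S T : ShortComplex A} (hS : S.ShortExact) (hT : T.ShortExact)
    (hS₂ : V S.X₂) (hT₂ : V T.X₂) (hS' : ExtendsAlong V S.f) (hT' : ExtendsAlong V T.f)
    (h : IsStableRetract V S.X₁ T.X₁) : IsStableRetract V S.X₃ T.X₃ := by
  obtain ⟨f, g, h⟩ := h
  have key {S T : ShortComplex A} (hS : S.ShortExact) (hT₂ : V T.X₂) (hS' : ExtendsAlong V S.f)
      (f : S.X₁ ⟶ T.X₁) : ∃ φ : S ⟶ T, φ.τ₁ = f := by
    have := hS.epi_g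
    obtain ⟨k, hk⟩ := hS' _ hT₂ (f ≫ T.f)
    have hk' : S.f ≫ k ≫ T.g = 0 := by rw [reassoc_of% hk]; simp
    exact ⟨⟨f, k, hS.exact.desc _ hk', hk.symm, (hS.exact.g_desc _ hk').symm⟩, rfl⟩
  obtain ⟨φ, rfl⟩ := key hS hT₂ hS' f
  obtain ⟨ψ, rfl⟩ := key hT hS₂ hT' g
  refine ⟨φ.τ₃, ψ.τ₃, ?_⟩
  refine FactorsThrough.τ₃ hS (𝟙 S - φ ≫ ψ) hS₂ hS' h

lemma IsStableRetract.down {S T : ShortComplex A} (hS : S.ShortExact) (hT : T.ShortExact)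
    (hS₂ : V S.X₂) (hT₂ : V T.X₂) (hS' : LiftsAlong V S.g) (hT' : LiftsAlong V T.g)
    (h : IsStableRetract V S.X₃ T.X₃) : IsStableRetract V S.X₁ T.X₁ := by
  obtain ⟨f, g, h⟩ := h
  have key {S T : ShortComplex A} (hT : T.ShortExact) (hS₂ : V S.X₂) (hT' : LiftsAlong V T.g)
      (f : S.X₃ ⟶ T.X₃) : ∃ φ : S ⟶ T, φ.τ₃ = f := by
    have := hT.mono_f
    obtain ⟨k, hk⟩ := hT' _ hS₂ (S.g ≫ f)
    have hk' : (S.f ≫ k) ≫ T.g = 0 := by rw [Category.assoc, hk]; simp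
    exact ⟨⟨hT.exact.lift _ hk', k, f, hT.exact.lift_f _ hk', hk⟩, rfl⟩
  obtain ⟨φ, rfl⟩ := key hT hS₂ hT' f
  obtain ⟨ψ, rfl⟩ := key hS hT₂ hS' g
  refine ⟨φ.τ₁, ψ.τ₁, ?_⟩
  refine FactorsThrough.τ₁ hS (𝟙 S - φ ≫ ψ) hS₂ hS' h

section

variable [HasExt.{w} A]

lemma leftPerp.extendsAlong {S : ShortComplex A} (hS : S.ShortExact) (h : leftPerp.{w} V S.X₃) :
    ExtendsAlong V S.f := fun W hW a => by
  have := h W hW 0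
  exact exists_extension_of_subsingleton_ext hS a

lemma rightPerp.liftsAlong {S : ShortComplex A} (hS : S.ShortExact) (h : rightPerp.{w} V S.X₁) :
    LiftsAlong V S.g := fun W hW a => by
  have := h W hW 0
  exact exists_lift_of_subsingleton_ext hS a

end

section

variable [HasExt.{w} A] [IsSelfOrthogonal.{w} V]

lemma IsStableRetract.of_iso {X Y : A} (e : X ≅ Y) : IsStableRetract V X Y := by
  obtain ⟨Z, hZ⟩ := HasZeroObject.zero (C := A)
  exact ⟨e.hom, e.inv, Z, 0, 0, IsSelfOrthogonal.zero.{w} _ hZ, by simp⟩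

lemma FactorsThrough.add {X Y : A} {f g : X ⟶ Y} (hf : FactorsThrough V f)
    (hg : FactorsThrough V g) : FactorsThrough V (f + g) := by
  obtain ⟨W, a, b, hW, rfl⟩ := hf
  obtain ⟨W', a', b', hW', rfl⟩ := hg
  exact ⟨W ⊞ W', biprod.lift a a', biprod.desc b b', IsSelfOrthogonal.biprod.{w} _ _ hW hW',
    by simp⟩

/-- If every morphism `M ⟶ Y` factors through `V`, then so does every morphism from `M` to a
stable retract of `Y`. -/
lemma IsStableRetract.factorsThrough {M X Y : A} (h : IsStableRetract V X Y)
    (hM : ∀ f : M ⟶ Y, FactorsThrough V f) (f : M ⟶ X) : FactorsThrough V f := by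
  obtain ⟨a, b, h⟩ := h
  have := FactorsThrough.add.{w} (h.comp_left f) ((hM (f ≫ a)).comp_right b)
  simpa [Preadditive.comp_sub] using this

/-- An object whose identity factors through `V` belongs to `V`. -/
lemma FactorsThrough.prop {X : A} (h : FactorsThrough V (𝟙 X)) : V X := by
  obtain ⟨W, a, b, hW, h⟩ := h
  exact IsSelfOrthogonal.retract.{w} a b h hW

end

end Stable

end Abelian

end RelativeTate

namespace RelativeTate

section Abelian

variable {A : Type u₁} [Category.{v₁} A] [Abelian A]

/-! ### Cycles of complexes and Hom-exactness. -/

section Complexes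

variable {ι : Type*} {c : ComplexShape ι} (K : HomologicalComplex A c) {i j k : ι}

lemma exactAt_homFrom_iff (X : A) (hi : c.prev j = i) (hk : c.next j = k) :
    (homFrom X K).ExactAt j ↔
      ∀ f : X ⟶ K.X j, f ≫ K.d j k = 0 → ∃ g : X ⟶ K.X i, g ≫ K.d i j = f := by
  rw [HomologicalComplex.exactAt_iff' _ i j k hi hk, ShortComplex.ab_exact_iff]
  rfl

lemma exactAt_homTo_iff (X : A) (hi : c.prev j = i) (hk : c.next j = k) :
    (homTo K X).ExactAt j ↔
      ∀ f : K.X j ⟶ X, K.d i j ≫ f = 0 → ∃ g : K.X k ⟶ X, K.d j k ≫ g = f := by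
  rw [HomologicalComplex.exactAt_iff' (c := c.symm) _ k j i hk hi, ShortComplex.ab_exact_iff]
  rfl

variable {K}

lemma shortExact_cycles (hjk : c.Rel j k) (hK : K.ExactAt k) :
    (ShortComplex.mk (K.iCycles j) (K.toCycles j k)
      (by simp [← cancel_mono (K.iCycles k)])).ShortExact := by
  have hepi : Epi (K.toCycles j k) := by
    have h := hK
    rw [K.exactAt_iff' j k _ (c.prev_eq' hjk) rfl, ShortComplex.exact_iff_epi_toCycles] at h
    rw [← K.toCycles_cyclesIsoSc'_hom j k _ (c.prev_eq' hjk) rfl] at h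
    exact (epi_comp_iff_of_isIso _ _).1 h
  have hex : (ShortComplex.mk (K.iCycles j) (K.d j k) (by simp)).Exact :=
    ShortComplex.exact_of_f_is_kernel _ (K.cyclesIsKernel j k (c.next_eq' hjk))
  refine { exact := ?_, mono_f := inferInstanceAs (Mono (K.iCycles j)), epi_g := hepi }
  let φ : ShortComplex.mk (K.iCycles j) (K.toCycles j k)
      (by simp [← cancel_mono (K.iCycles k)]) ⟶
      ShortComplex.mk (K.iCycles j) (K.d j k) (by simp) :=
    { τ₁ := 𝟙 _, τ₂ := 𝟙 _, τ₃ := K.iCycles k }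
  have : Epi φ.τ₁ := inferInstanceAs (Epi (𝟙 _))
  have : IsIso φ.τ₂ := inferInstanceAs (IsIso (𝟙 _))
  have : Mono φ.τ₃ := inferInstanceAs (Mono (K.iCycles k))
  exact (ShortComplex.exact_iff_of_epi_of_isIso_of_mono φ).2 hex

/-- The short complex `0 ⟶ Zʲ ⟶ Kʲ ⟶ Zᵏ ⟶ 0` attached to a complex. -/
noncomputable abbrev cyclesSequence (K : HomologicalComplex A c) (j k : ι) : ShortComplex A :=
  ShortComplex.mk (K.iCycles j) (K.toCycles j k) (by simp [← cancel_mono (K.iCycles k)])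

variable {V : ObjectProperty A}

lemma liftsAlong_toCycles (hV : IsHomFromExact V K) (hjk : c.Rel j k) :
    LiftsAlong V (K.toCycles j k) := fun W hW b => by
  obtain ⟨g, hg⟩ := (exactAt_homFrom_iff K W (c.prev_eq' hjk) rfl).1 (hV W hW k)
    (b ≫ K.iCycles k) (by simp)
  exact ⟨g, by rw [← cancel_mono (K.iCycles k), Category.assoc, K.toCycles_i, hg]⟩

lemma extendsAlong_iCycles (hV : IsHomToExact V K) (hjk : c.Rel j k) (hK : K.ExactAt k) :
    ExtendsAlong V (K.iCycles k) := fun W hW a => by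
  obtain ⟨g, hg⟩ := (exactAt_homTo_iff K W rfl (c.next_eq' hjk)).1 (hV W hW j)
    (K.toCycles j k ≫ a) (by simp)
  have := (shortExact_cycles hjk hK).epi_g
  exact ⟨g, by rw [← cancel_epi (K.toCycles j k), ← Category.assoc, K.toCycles_i, hg]⟩

/-- The cokernel of a differential of an exact complex. -/
noncomputable def cokernelIsoCycles (hij : c.Rel i j) (hjk : c.Rel j k) (hj : K.ExactAt j)
    (hk : K.ExactAt k) : cokernel (K.d i j) ≅ K.cycles k :=
  have hS := shortExact_cycles hjk hk
  have hT := shortExact_cycles hij hj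
  have := hT.epi_g
  IsColimit.coconePointUniqueUpToIso (cokernelIsCokernel (K.d i j))
    (isCokernelEpiComp hS.gIsCokernel (K.toCycles i j) (by simp))

end Complexes

/-! ### Splicing short exact sequences into a complex. -/

section Splice

/-- The complex is presented by its fields so that its objects are definitionally the given `X n`,
and no transport is needed in the formula for the differential. -/
lemma exists_splice {Z X : ℤ → A} (i : ∀ n, Z n ⟶ X n) (p : ∀ n, X n ⟶ Z (n + 1))
    (w : ∀ n, i n ≫ p n = 0) : ∃ (d : ∀ m n, X m ⟶ X n) (shape : _) (comp : _),
      ∀ n, (HomologicalComplex.mk (c := ComplexShape.up ℤ) X d shape comp).d n (n + 1) =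
        p n ≫ i (n + 1) := by
  let K := CochainComplex.of X (fun n => p n ≫ i (n + 1))
    (fun n => by simp [reassoc_of% (w (n + 1))])
  exact ⟨K.d, K.shape, K.d_comp_d', fun n => CochainComplex.of_d X (fun n => p n ≫ i (n + 1)) n⟩

variable {Z : ℤ → A} {K : CochainComplex A ℤ} {i : ∀ n, Z n ⟶ K.X n} {p : ∀ n, K.X n ⟶ Z (n + 1)}
  {w : ∀ n, i n ≫ p n = 0} (hd : ∀ n, K.d n (n + 1) = p n ≫ i (n + 1))
  (h : ∀ n, (ShortComplex.mk (i n) (p n) (w n)).ShortExact)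

include hd h

lemma acyclic_of_splice : K.Acyclic := fun n => by
  obtain ⟨m, rfl⟩ : ∃ m, n = m + 1 := ⟨n - 1, by simp⟩
  rw [HomologicalComplex.exactAt_iff' _ m (m + 1) (m + 1 + 1) (by simp) (by simp)]
  have hi := (h (m + 1 + 1)).mono_f
  have hp := (h m).epi_g
  let φ : K.sc' m (m + 1) (m + 1 + 1) ⟶
      ShortComplex.mk (i (m + 1)) (p (m + 1) ≫ i (m + 1 + 1)) (by simp [reassoc_of% w]) :=
    { τ₁ := p m
      τ₂ := 𝟙 _
      τ₃ := 𝟙 _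
      comm₁₂ := (hd m).symm.trans (Category.comp_id _).symm
      comm₂₃ := (Category.id_comp _).trans ((hd (m + 1)).symm.trans (Category.comp_id _).symm) }
  have : Epi φ.τ₁ := hp
  have : IsIso φ.τ₂ := inferInstanceAs (IsIso (𝟙 _))
  have : Mono φ.τ₃ := inferInstanceAs (Mono (𝟙 _))
  rw [ShortComplex.exact_iff_of_epi_of_isIso_of_mono φ]
  let ψ : ShortComplex.mk (i (m + 1)) (p (m + 1)) (w (m + 1)) ⟶
      ShortComplex.mk (i (m + 1)) (p (m + 1) ≫ i (m + 1 + 1)) (by simp [reassoc_of% w]) :=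
    { τ₁ := 𝟙 _, τ₂ := 𝟙 _, τ₃ := i (m + 1 + 1) }
  have : Epi ψ.τ₁ := inferInstanceAs (Epi (𝟙 _))
  have : IsIso ψ.τ₂ := inferInstanceAs (IsIso (𝟙 _))
  have : Mono ψ.τ₃ := hi
  exact (ShortComplex.exact_iff_of_epi_of_isIso_of_mono ψ).1 (h (m + 1)).exact

variable {V : ObjectProperty A}

lemma isHomFromExact_of_splice (hp : ∀ n, LiftsAlong V (p n)) : IsHomFromExact V K :=
  fun W hW n => by
    obtain ⟨m, rfl⟩ : ∃ m, n = m + 1 := ⟨n - 1, by simp⟩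
    rw [exactAt_homFrom_iff _ _ (i := m) (k := m + 1 + 1) (by simp) (by simp)]
    intro f hf
    have : Mono (i (m + 1 + 1)) := (h (m + 1 + 1)).mono_f
    have := (h (m + 1)).mono_f
    have hf' : f ≫ p (m + 1) = 0 := by
      rw [← cancel_mono (i (m + 1 + 1)), Category.assoc, ← hd, hf, zero_comp]
    obtain ⟨g, hg⟩ := hp m W hW ((h (m + 1)).exact.lift f hf')
    exact ⟨g, by rw [hd, reassoc_of% hg]; exact (h (m + 1)).exact.lift_f f hf'⟩

lemma isHomToExact_of_splice (hi : ∀ n, ExtendsAlong V (i n)) : IsHomToExact V K :=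
  fun W hW n => by
    obtain ⟨m, rfl⟩ : ∃ m, n = m + 1 := ⟨n - 1, by simp⟩
    rw [exactAt_homTo_iff _ _ (i := m) (k := m + 1 + 1) (by simp) (by simp)]
    intro f hf
    have : Epi (p m) := (h m).epi_g
    have := (h (m + 1)).epi_g
    have hf' : i (m + 1) ≫ f = 0 := by
      rw [← cancel_epi (p m), ← Category.assoc, ← hd, hf, comp_zero]
    obtain ⟨g, hg⟩ := hi (m + 1 + 1) W hW ((h (m + 1)).exact.desc f hf')
    exact ⟨g, by rw [hd, Category.assoc, hg]; exact (h (m + 1)).exact.g_desc f hf'⟩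

/-- The cycles of a complex that is spliced from short exact sequences. -/
noncomputable def cyclesIsoOfSplice (n : ℤ) : Z n ≅ K.cycles n :=
  have : Mono (i (n + 1)) := (h (n + 1)).mono_f
  IsLimit.conePointUniqueUpToIso
    (isKernelCompMono (h n).fIsKernel (i (n + 1)) (hd n))
    (K.cyclesIsKernel n (n + 1) (by simp))

end Splice

/-! ### Cycles of totally acyclic complexes. -/

section Gorenstein

variable {V : ObjectProperty A}

/-- There is a short exact sequence `0 ⟶ X₁ ⟶ X₂ ⟶ X₃ ⟶ 0` with `X₂` in `V`. -/
def IsExtensionIn (V : ObjectProperty A) (X₁ X₃ : A) : Prop := ∃ X₂, V X₂ ∧ IsExtension X₁ X₂ X₃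

/-- The objects that occur as cycles, in any given degree, of a totally `V`-acyclic complex. -/
def IsTateCycle (V : ObjectProperty A) : ObjectProperty A := fun G =>
  ∀ k : ℤ, ∃ S : CochainComplex A ℤ, IsTotallyAcyclic V S ∧ Nonempty (G ≅ S.cycles k)

lemma IsTotallyAcyclic.shortExact {S : CochainComplex A ℤ} (hS : IsTotallyAcyclic V S) {j k : ℤ}
    (h : j + 1 = k) : (cyclesSequence S j k).ShortExact :=
  shortExact_cycles h (hS.exact k)

lemma IsTotallyAcyclic.extendsAlong {S : CochainComplex A ℤ} (hS : IsTotallyAcyclic V S) (k : ℤ) :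
    ExtendsAlong V (S.iCycles k) :=
  extendsAlong_iCycles (j := k - 1) hS.homTo_exact (by simp) (hS.exact k)

lemma IsTotallyAcyclic.liftsAlong {S : CochainComplex A ℤ} (hS : IsTotallyAcyclic V S) {j k : ℤ}
    (h : j + 1 = k) : LiftsAlong V (S.toCycles j k) :=
  liftsAlong_toCycles hS.homFrom_exact h

lemma IsTotallyAcyclic.isExtensionIn {S : CochainComplex A ℤ} (hS : IsTotallyAcyclic V S) {j k : ℤ}
    (h : j + 1 = k) : IsExtensionIn V (S.cycles j) (S.cycles k) :=
  ⟨S.X j, hS.mem j, IsExtension.of_shortExact (hS.shortExact h)⟩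

variable [HasExt.{w} A]

section

variable [IsSelfOrthogonal.{w} V]

/-- Dimension shifting along `0 → Zⁿ⁻¹ → Sⁿ⁻¹ → Zⁿ → 0` lowers the Ext degree together with `n`; in
degree one, `Hom(-, V)`-exactness supplies the needed extensions. -/
lemma IsTotallyAcyclic.leftPerp_cycles {S : CochainComplex A ℤ} (hS : IsTotallyAcyclic V S)
    (n : ℤ) : leftPerp.{w} V (S.cycles n) := fun W hW i => by
  induction i generalizing n with
  | zero =>
    have := IsSelfOrthogonal.leftPerp.{w} (hS.mem (n - 1)) W hW 0
    exact subsingleton_ext_one_of_exists_extension (hS.shortExact (sub_add_cancel n 1))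
      fun f => hS.extendsAlong (n - 1) W hW f
  | succ i ih =>
    have := IsSelfOrthogonal.leftPerp.{w} (hS.mem (n - 1)) W hW (i + 1)
    have := ih (n - 1)
    exact subsingleton_ext_X₃_left (hS.shortExact (sub_add_cancel n 1)) W (Nat.add_comm 1 (i + 1))

lemma IsTotallyAcyclic.rightPerp_cycles {S : CochainComplex A ℤ} (hS : IsTotallyAcyclic V S)
    (n : ℤ) : rightPerp.{w} V (S.cycles n) := fun W hW i => by
  induction i generalizing n with
  | zero =>
    have := IsSelfOrthogonal.rightPerp.{w} (hS.mem n) W hW 0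
    exact subsingleton_ext_one_of_exists_lift (hS.shortExact (rfl : n + 1 = n + 1))
      fun f => hS.liftsAlong rfl W hW f
  | succ i ih =>
    have := IsSelfOrthogonal.rightPerp.{w} (hS.mem n) W hW (i + 1)
    have := ih (n + 1)
    exact subsingleton_ext_X₁_right (hS.shortExact (rfl : n + 1 = n + 1)) W rfl

lemma IsTateCycle.leftPerp {G : A} (hG : IsTateCycle V G) : leftPerp.{w} V G := by
  obtain ⟨S, hS, ⟨e⟩⟩ := hG 0
  exact leftPerp.of_iso e.symm (hS.leftPerp_cycles 0)

lemma IsTateCycle.rightPerp {G : A} (hG : IsTateCycle V G) : rightPerp.{w} V G := by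
  obtain ⟨S, hS, ⟨e⟩⟩ := hG 0
  exact rightPerp.of_iso e.symm (hS.rightPerp_cycles 0)

end

/-- A class of objects of `leftPerp V` and `rightPerp V` every member of which can be embedded in
an object of `V`, and covered by an object of `V`, within the class, consists of cycles of totally
`V`-acyclic complexes. -/
lemma isTateCycle_of_coinduction (P : ObjectProperty A) (hl : P ≤ leftPerp.{w} V)
    (hr : P ≤ rightPerp.{w} V) (hup : ∀ G, P G → ∃ G', P G' ∧ IsExtensionIn V G G')
    (hdown : ∀ G, P G → ∃ G', P G' ∧ IsExtensionIn V G' G) : P ≤ IsTateCycle V := by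
  intro G hG k
  choose up hup hup' using fun G : Subtype P => hup G.1 G.2
  choose down hdown hdown' using fun G : Subtype P => hdown G.1 G.2
  -- Embeddings are iterated to the right of `G` and coverings to the left. Since `.negSucc n` is
  -- `-(n + 1)`, it needs `n + 1` iterations.
  let Z : ℤ → Subtype P
    | .ofNat n => (fun G => ⟨up G, hup G⟩)^[n] ⟨G, hG⟩
    | .negSucc n => (fun G => ⟨down G, hdown G⟩)^[n + 1] ⟨G, hG⟩
  have hZ : ∀ n, IsExtensionIn V (Z n).1 (Z (n + 1)).1
    | .ofNat n => by
      have : Z (.ofNat n + 1) = ⟨up (Z (.ofNat n)), hup _⟩ := Function.iterate_succ_apply' _ _ _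
      rw [this]
      exact hup' _
    | .negSucc 0 => hdown' ⟨G, hG⟩
    | .negSucc (n + 1) => by
      have : Z (.negSucc (n + 1)) = ⟨down (Z (.negSucc n)), hdown _⟩ :=
        Function.iterate_succ_apply' _ _ _
      rw [this]
      exact hdown' _
  -- Reindexing by `k` puts `G` in degree `k`.
  have hZ' : ∀ n, IsExtensionIn V (Z (n - k)).1 (Z (n + 1 - k)).1 := fun n => by
    have := hZ (n - k)
    rwa [sub_add_eq_add_sub] at this
  choose X hX i p w h using hZ'
  obtain ⟨d, shape, comp, hd⟩ := exists_splice i p w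
  refine ⟨HomologicalComplex.mk X d shape comp, ⟨hX, acyclic_of_splice hd h,
    isHomFromExact_of_splice hd h fun n => (hr _ (Z (n - k)).2).liftsAlong (h n),
    isHomToExact_of_splice hd h fun n => (hl _ (Z (n + 1 - k)).2).extendsAlong (h n)⟩, ⟨?_⟩⟩
  exact eqToIso (by simp [Z]) ≪≫ cyclesIsoOfSplice hd h k

variable [IsSelfOrthogonal.{w} V]

/-- The cycles of `S` in all degrees form a class to which the coinduction principle applies; this
replaces a shift of `S`. -/
lemma IsTotallyAcyclic.isTateCycle {S : CochainComplex A ℤ} (hS : IsTotallyAcyclic V S) (n : ℤ) :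
    IsTateCycle V (S.cycles n) := by
  refine isTateCycle_of_coinduction.{w} (fun G => ∃ n, G = S.cycles n) ?_ ?_ ?_ ?_ _ ⟨n, rfl⟩
  · rintro _ ⟨n, rfl⟩
    exact hS.leftPerp_cycles n
  · rintro _ ⟨n, rfl⟩
    exact hS.rightPerp_cycles n
  · rintro _ ⟨n, rfl⟩
    exact ⟨_, ⟨n + 1, rfl⟩, hS.isExtensionIn rfl⟩
  · rintro _ ⟨n, rfl⟩
    exact ⟨_, ⟨n - 1, rfl⟩, hS.isExtensionIn (sub_add_cancel n 1)⟩

lemma IsTateCycle.of_iso {X Y : A} (e : X ≅ Y) (h : IsTateCycle V X) : IsTateCycle V Y := fun k =>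
  let ⟨S, hS, ⟨e'⟩⟩ := h k
  ⟨S, hS, ⟨e.symm ≪≫ e'⟩⟩

/-- By exactness, the cokernel of `S⁻¹ ⟶ S⁰` is the object of cycles in degree `1`. -/
lemma isTateCycle_of_gorenstein {G : A} (hG : gorenstein V G) : IsTateCycle V G := by
  obtain ⟨S, hS, ⟨e⟩⟩ := hG
  exact IsTateCycle.of_iso.{w} (e ≪≫ cokernelIsoCycles (k := 1) (by simp) (by simp) (hS.exact _)
    (hS.exact _)).symm (hS.isTateCycle 1)

lemma IsTateCycle.exists_up {G : A} (hG : IsTateCycle V G) :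
    ∃ G', IsTateCycle V G' ∧ IsExtensionIn V G G' := by
  obtain ⟨S, hS, ⟨e⟩⟩ := hG 0
  obtain ⟨X, hX, h⟩ := hS.isExtensionIn (rfl : (0 : ℤ) + 1 = 0 + 1)
  exact ⟨_, hS.isTateCycle.{w} _, X, hX, h.of_iso e.symm (Iso.refl _)⟩

lemma IsTateCycle.exists_down {G : A} (hG : IsTateCycle V G) :
    ∃ G', IsTateCycle V G' ∧ IsExtensionIn V G' G := by
  obtain ⟨S, hS, ⟨e⟩⟩ := hG 0
  obtain ⟨X, hX, h⟩ := hS.isExtensionIn (by simp : (-1 : ℤ) + 1 = 0)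
  exact ⟨_, hS.isTateCycle.{w} _, X, hX, h.of_iso (Iso.refl _) e.symm⟩

/-- One step of the horseshoe lemma for coresolutions. -/
lemma exists_horseshoe_up {X₁ X₂ X₃ Y₁ Y₃ : A} (h : IsExtension X₁ X₂ X₃)
    (h₁ : IsExtensionIn V X₁ Y₁) (h₃ : IsExtensionIn V X₃ Y₃) (hX₃ : leftPerp.{w} V X₃) :
    ∃ Y₂, IsExtensionIn V X₂ Y₂ ∧ IsExtension Y₁ Y₂ Y₃ := by
  obtain ⟨f, g, w, h⟩ := h
  obtain ⟨W₁, hW₁, f₁, g₁, w₁, h₁⟩ := h₁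
  obtain ⟨W₃, hW₃, f₃, g₃, w₃, h₃⟩ := h₃
  -- As `Ext¹(X₃, W₁) = 0`, the embedding of `X₁` in `W₁` extends to `X₂`; together with `g ≫ f₃` it
  -- gives the middle map into `W₁ ⊞ W₃`.
  obtain ⟨u, hu⟩ := hX₃.extendsAlong h W₁ hW₁ f₁
  dsimp at u hu
  obtain ⟨Q, hQ, hQ'⟩ := exists_cokernel_extension h
    (ShortComplex.Splitting.ofHasBinaryBiproduct W₁ W₃).shortExact
    { τ₁ := f₁
      τ₂ := biprod.lift u (g ≫ f₃)
      τ₃ := f₃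
      comm₁₂ := by ext <;> simp [hu, reassoc_of% w]
      comm₂₃ := by simp } h₁ h₃
  exact ⟨Q, ⟨_, IsSelfOrthogonal.biprod.{w} _ _ hW₁ hW₃, hQ⟩, hQ'⟩

/-- One step of the horseshoe lemma for resolutions. -/
lemma exists_horseshoe_down {X₁ X₂ X₃ Y₁ Y₃ : A} (h : IsExtension X₁ X₂ X₃)
    (h₁ : IsExtensionIn V Y₁ X₁) (h₃ : IsExtensionIn V Y₃ X₃) (hX₁ : rightPerp.{w} V X₁) :
    ∃ Y₂, IsExtensionIn V Y₂ X₂ ∧ IsExtension Y₁ Y₂ Y₃ := by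
  obtain ⟨f, g, w, h⟩ := h
  obtain ⟨W₁, hW₁, f₁, g₁, w₁, h₁⟩ := h₁
  obtain ⟨W₃, hW₃, f₃, g₃, w₃, h₃⟩ := h₃
  obtain ⟨u, hu⟩ := hX₁.liftsAlong h W₃ hW₃ g₃
  dsimp at u hu
  obtain ⟨Q, hQ, hQ'⟩ := exists_kernel_extension
    (ShortComplex.Splitting.ofHasBinaryBiproduct W₁ W₃).shortExact h
    { τ₁ := g₁
      τ₂ := biprod.desc (g₁ ≫ f) u
      τ₃ := g₃
      comm₁₂ := by simp
      comm₂₃ := by ext <;> simp [hu, w] } h₁ h₃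
  exact ⟨Q, ⟨_, IsSelfOrthogonal.biprod.{w} _ _ hW₁ hW₃, hQ⟩, hQ'⟩

/-- Cycles of totally `V`-acyclic complexes are closed under extensions. -/
lemma IsTateCycle.of_extension {X₁ X₂ X₃ : A} (h : IsExtension X₁ X₂ X₃)
    (h₁ : IsTateCycle V X₁) (h₃ : IsTateCycle V X₃) : IsTateCycle V X₂ := by
  -- The class of all extensions of one cycle by another is stable under the two horseshoe steps,
  -- hence coinductive.
  refine isTateCycle_of_coinduction.{w} (fun Q => ∃ X₁ X₃, IsTateCycle V X₁ ∧ IsTateCycle V X₃ ∧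
    IsExtension X₁ Q X₃) ?_ ?_ ?_ ?_ _ ⟨X₁, X₃, h₁, h₃, h⟩
  · rintro Q ⟨X₁, X₃, h₁, h₃, h⟩
    exact leftPerp.of_extension h h₁.leftPerp h₃.leftPerp
  · rintro Q ⟨X₁, X₃, h₁, h₃, h⟩
    exact rightPerp.of_extension h h₁.rightPerp h₃.rightPerp
  · rintro Q ⟨X₁, X₃, h₁, h₃, h⟩
    obtain ⟨Y₁, hY₁, e₁⟩ := IsTateCycle.exists_up.{w} h₁
    obtain ⟨Y₃, hY₃, e₃⟩ := IsTateCycle.exists_up.{w} h₃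
    obtain ⟨Y, hY, e⟩ := exists_horseshoe_up.{w} h e₁ e₃ h₃.leftPerp
    exact ⟨Y, ⟨Y₁, Y₃, hY₁, hY₃, e⟩, hY⟩
  · rintro Q ⟨X₁, X₃, h₁, h₃, h⟩
    obtain ⟨Y₁, hY₁, e₁⟩ := IsTateCycle.exists_down.{w} h₁
    obtain ⟨Y₃, hY₃, e₃⟩ := IsTateCycle.exists_down.{w} h₃
    obtain ⟨Y, hY, e⟩ := exists_horseshoe_down.{w} h e₁ e₃ h₁.rightPerp
    exact ⟨Y, ⟨Y₁, Y₃, hY₁, hY₃, e⟩, hY⟩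

end Gorenstein

end Abelian

end RelativeTate

namespace RelativeTate

section Abelian

variable {A : Type u₁} [Category.{v₁} A] [Abelian A]

/-! ### Exactness of augmented complexes. -/

section Augment

lemma exactAt_succ_iff (K : CochainComplex A ℕ) (n : ℕ) :
    K.ExactAt (n + 1) ↔
      (ShortComplex.mk (K.d n (n + 1)) (K.d (n + 1) (n + 2)) (K.d_comp_d _ _ _)).Exact :=
  K.exactAt_iff' n (n + 1) (n + 2) (by simp) (by simp)

/-- Degree `0` has no predecessor, so `prev 0` takes the default value `0`, and `d 0 0 = 0`. -/
lemma exactAt_zero_iff (K : CochainComplex A ℕ) : K.ExactAt 0 ↔ Mono (K.d 0 1) := by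
  rw [K.exactAt_iff' 0 0 1 (by simp) (by simp)]
  exact ShortComplex.exact_iff_mono _ (K.shape _ _ (by simp))

lemma acyclic_augment_iff (K : CochainComplex A ℕ) {N : A} (f : N ⟶ K.X 0) (w : f ≫ K.d 0 1 = 0) :
    (K.augment f w).Acyclic ↔
      Mono f ∧ (ShortComplex.mk f (K.d 0 1) w).Exact ∧ ∀ n, K.ExactAt (n + 1) := by
  constructor
  · intro h
    exact ⟨(exactAt_zero_iff _).1 (h 0), (exactAt_succ_iff _ _).1 (h 1),
      fun n => (exactAt_succ_iff K n).2
        ((exactAt_succ_iff (K.augment f w) (n + 1)).1 (h (n + 2)))⟩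
  · rintro ⟨h₀, h₁, h₂⟩ n
    match n with
    | 0 => exact (exactAt_zero_iff _).2 h₀
    | 1 => exact (exactAt_succ_iff _ _).2 h₁
    | n + 2 => exact (exactAt_succ_iff (K.augment f w) (n + 1)).2 ((exactAt_succ_iff K n).1 (h₂ n))

lemma isHomToExact_augment_iff (V : ObjectProperty A) (K : CochainComplex A ℕ) {N : A}
    (f : N ⟶ K.X 0) (w : f ≫ K.d 0 1 = 0) :
    IsHomToExact V (K.augment f w) ↔ ExtendsAlong V f ∧ ∀ W, V W →
      (∀ b : K.X 0 ⟶ W, f ≫ b = 0 → ∃ g : K.X 1 ⟶ W, K.d 0 1 ≫ g = b) ∧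
      ∀ n, ∀ b : K.X (n + 1) ⟶ W, K.d n (n + 1) ≫ b = 0 →
        ∃ g : K.X (n + 2) ⟶ W, K.d (n + 1) (n + 2) ≫ g = b := by
  have h₀ (W : A) : (homTo (K.augment f w) W).ExactAt 0 ↔
      ∀ a : N ⟶ W, ∃ u : K.X 0 ⟶ W, f ≫ u = a := by
    -- The predecessor of `0` defaults to `0`, so the cocycle condition involves `d 0 0 = 0` and is
    -- void.
    rw [exactAt_homTo_iff (K.augment f w) W (i := 0) (j := 0) (k := 1) (by simp) (by simp)]
    exact forall_congr' fun a => ⟨fun h => h (by rw [(K.augment f w).shape 0 0 (by simp)]; exact zero_comp),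
      fun h _ => h⟩
  have h₁ (W : A) (n : ℕ) : (homTo (K.augment f w) W).ExactAt (n + 1) ↔ _ :=
    exactAt_homTo_iff (K.augment f w) W (i := n) (k := n + 2) (by simp) (by simp)
  constructor
  · intro h
    exact ⟨fun W hW => (h₀ W).1 (h W hW 0), fun W hW => ⟨(h₁ W 0).1 (h W hW 1),
      fun n => (h₁ W (n + 1)).1 (h W hW (n + 2))⟩⟩
  · rintro ⟨h, h'⟩ W hW n
    match n with
    | 0 => exact (h₀ W).2 (h W hW)
    | 1 => exact (h₁ W 0).2 (h' W hW).1
    | n + 2 => exact (h₁ W (n + 1)).2 ((h' W hW).2 n)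

end Augment

/-! ### Proper and finite coresolutions. -/

section Coresolution

variable {V : ObjectProperty A}

namespace Coresolution

variable {N : A} (Y : Coresolution V N)

lemma exactAt_succ (n : ℕ) : Y.complex.ExactAt (n + 1) :=
  ((acyclic_augment_iff _ _ _).1 Y.exact).2.2 n

lemma shortExact (n : ℕ) : (cyclesSequence Y.complex n (n + 1)).ShortExact :=
  shortExact_cycles (by simp) (Y.exactAt_succ n)

/-- The object is isomorphic to the cycles in degree `0` of its coresolutions. -/
noncomputable def isoCycles : N ≅ Y.complex.cycles 0 :=
  have h := (acyclic_augment_iff _ _ _).1 Y.exact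
  have := h.1
  IsLimit.conePointUniqueUpToIso h.2.1.fIsKernel (Y.complex.cyclesIsKernel 0 1 (by simp))

@[simp]
lemma isoCycles_hom_iCycles : Y.isoCycles.hom ≫ Y.complex.iCycles 0 = Y.ι :=
  IsLimit.conePointUniqueUpToIso_hom_comp _ _ WalkingParallelPair.zero

/-- A morphism on cycles in degree `n + 1` pulls back to a cocycle on `Yⁿ`, which properness
extends; in degree `0` the cycles are `N` itself. -/
lemma IsProper.extendsAlong {Y : Coresolution V N} (hY : Y.IsProper) :
    ∀ n, ExtendsAlong V (Y.complex.iCycles n)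
  | 0 => fun W hW a => by
    obtain ⟨u, hu⟩ := ((isHomToExact_augment_iff _ _ _ _).1 hY).1 W hW (Y.isoCycles.hom ≫ a)
    refine ⟨u, ?_⟩
    rw [← cancel_epi Y.isoCycles.hom, ← Category.assoc, isoCycles_hom_iCycles, hu]
  | n + 1 => fun W hW a => by
    have hS := ((isHomToExact_augment_iff _ _ _ _).1 hY).2 W hW
    have hk : ∃ u : Y.complex.X (n + 1) ⟶ W,
        Y.complex.d n (n + 1) ≫ u = Y.complex.toCycles n (n + 1) ≫ a := by
      cases n with
      | zero =>
        refine hS.1 _ ?_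
        rw [← isoCycles_hom_iCycles, Category.assoc,
          reassoc_of% (cyclesSequence Y.complex 0 1).zero, zero_comp, comp_zero]
      | succ n => exact hS.2 n _ (by simp)
    obtain ⟨u, hu⟩ := hk
    have := (Y.shortExact n).epi_g
    exact ⟨u, by rw [← cancel_epi (Y.complex.toCycles n (n + 1)), ← Category.assoc,
      HomologicalComplex.toCycles_i, hu]⟩

variable {X M : A} {f : M ⟶ X} {g : X ⟶ N} {w : f ≫ g = 0}

/-- Prolong a coresolution of `N` to the left along an exact sequence `0 ⟶ M ⟶ X ⟶ N ⟶ 0`. -/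
noncomputable def cons (h : (ShortComplex.mk f g w).ShortExact) (hX : V X) : Coresolution V M where
  complex := Y.complex.augment (g ≫ Y.ι) (by simp [Y.ι_d])
  ι := f
  ι_d := by
    change f ≫ g ≫ Y.ι = 0
    rw [reassoc_of% w, zero_comp]
  mem
    | 0 => hX
    | n + 1 => Y.mem n
  exact := by
    obtain ⟨h₀, h₁, h₂⟩ := (acyclic_augment_iff _ _ _).1 Y.exact
    have hg := h.epi_g
    refine (acyclic_augment_iff _ _ _).2 ⟨h.mono_f, ?_, fun n => ?_⟩
    · let φ : ShortComplex.mk f g w ⟶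
        ShortComplex.mk f (g ≫ Y.ι) (by rw [reassoc_of% w, zero_comp]) :=
        { τ₁ := 𝟙 _, τ₂ := 𝟙 _, τ₃ := Y.ι }
      have : Epi φ.τ₁ := inferInstanceAs (Epi (𝟙 _))
      have : IsIso φ.τ₂ := inferInstanceAs (IsIso (𝟙 _))
      have : Mono φ.τ₃ := h₀
      exact (ShortComplex.exact_iff_of_epi_of_isIso_of_mono φ).1 h.exact
    · refine (exactAt_succ_iff _ _).2 ?_
      cases n with
      | zero =>
        let φ : ShortComplex.mk (g ≫ Y.ι) (Y.complex.d 0 1) (by simp [Y.ι_d]) ⟶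
          ShortComplex.mk Y.ι (Y.complex.d 0 1) Y.ι_d :=
          { τ₁ := g, τ₂ := 𝟙 _, τ₃ := 𝟙 _ }
        have : Epi φ.τ₁ := hg
        have : IsIso φ.τ₂ := inferInstanceAs (IsIso (𝟙 _))
        have : Mono φ.τ₃ := inferInstanceAs (Mono (𝟙 _))
        exact (ShortComplex.exact_iff_of_epi_of_isIso_of_mono φ).2 h₁
      | succ n => exact (exactAt_succ_iff Y.complex n).1 (h₂ n)

lemma IsProper.cons {Y : Coresolution V N} (hY : Y.IsProper)
    (h : (ShortComplex.mk f g w).ShortExact) (hX : V X) (hf : ExtendsAlong V f) :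
    (Y.cons h hX).IsProper := by
  have hg := h.epi_g
  obtain ⟨h₀, h₁⟩ := (isHomToExact_augment_iff _ _ _ _).1 hY
  refine (isHomToExact_augment_iff _ _ _ _).2 ⟨hf, fun W hW => ⟨fun b hb => ?_, fun n b hb => ?_⟩⟩
  · obtain ⟨u, hu⟩ := h₀ W hW (h.exact.desc b hb)
    refine ⟨u, ?_⟩
    change (g ≫ Y.ι) ≫ u = b
    rw [Category.assoc, hu]
    exact h.exact.g_desc b hb
  · cases n with
    | zero =>
      exact (h₁ W hW).1 b ((cancel_epi g).1
        (((Category.assoc g Y.ι b).symm.trans hb).trans comp_zero.symm))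
    | succ n => exact (h₁ W hW).2 n b hb

end Coresolution

/-- The objects `M` that admit an exact sequence `0 ⟶ M ⟶ X⁰ ⟶ ⋯ ⟶ Xᵈ⁻¹ ⟶ B ⟶ 0` with all `Xⁱ`
in `V` and with `B` in `W`. -/
def finiteCoresolution (V W : ObjectProperty A) : ℕ → ObjectProperty A
  | 0 => W
  | d + 1 => fun M => ∃ M', finiteCoresolution V W d M' ∧ IsExtensionIn V M M'

lemma finiteCoresolution_mono {V V' W W' : ObjectProperty A} (hV : V ≤ V') (hW : W ≤ W') (d : ℕ) :
    finiteCoresolution V W d ≤ finiteCoresolution V' W' d := by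
  induction d with
  | zero => exact hW
  | succ d ih =>
    rintro M ⟨M', h, X, hX, e⟩
    exact ⟨M', ih _ h, X, hV _ hX, e⟩

lemma exists_finiteCoresolution_of_injDim_lt_top
    (hV : ∀ {X Y : A}, (X ≅ Y) → V X → V Y) {M : A} (h : injDim V M < ⊤) :
    ∃ d, finiteCoresolution V V d M := by
  obtain ⟨Y, hY⟩ := iInf_lt_iff.1 h
  obtain ⟨d, hd⟩ := ENat.ne_top_iff_exists.1 hY.ne
  have hz : ∀ n, d < n → IsZero (Y.complex.X n) := fun n hn => by
    by_contra hn'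
    have : (n : ℕ∞) ≤ Y.length := le_iSup₂_of_le (f := fun (n : ℕ) _ => (n : ℕ∞)) n hn' le_rfl
    rw [← hd] at this
    exact absurd (Nat.cast_le.1 this) (by omega)
  have key : ∀ k n, n + k = d → finiteCoresolution V V k (Y.complex.cycles n) := fun k => by
    induction k with
    | zero =>
      rintro n rfl
      have hS := Y.shortExact n
      -- In the top degree the next cycles embed in a zero object, so the last cycles are the whole
      -- term and lie in `V`.
      have : IsIso (Y.complex.iCycles n) := hS.isIso_f_iff.2
        (IsZero.of_mono (Y.complex.iCycles (n + 1)) (hz _ (by omega)))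
      exact hV (asIso (Y.complex.iCycles n)).symm (Y.mem n)
    | succ k ih =>
      intro n hn
      exact ⟨_, ih (n + 1) (by omega), _, Y.mem n, IsExtension.of_shortExact (Y.shortExact n)⟩
  refine ⟨d, ?_⟩
  have h₀ := key d 0 (Nat.zero_add d)
  cases d with
  | zero => exact hV Y.isoCycles.symm h₀
  | succ d =>
    obtain ⟨M', h', X, hX, e⟩ := h₀
    exact ⟨M', h', X, hX, e.of_iso Y.isoCycles.symm (Iso.refl _)⟩

variable [HasExt.{w} A] [IsSelfOrthogonal.{w} V]

/-- The zero coresolution of a zero object. -/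
noncomputable def zeroCoresolution (V : ObjectProperty A) [IsSelfOrthogonal.{w} V] {N : A}
    (hN : IsZero N) : Coresolution V N where
  complex := { X := fun _ => N, d := fun _ _ => 0 }
  ι := 0
  ι_d := by simp
  mem _ := IsSelfOrthogonal.zero.{w} _ hN
  exact := by
    rw [acyclic_augment_iff]
    exact ⟨⟨fun _ _ _ => hN.eq_of_tgt _ _⟩, ShortComplex.exact_of_isZero_X₂ _ hN,
      fun n => HomologicalComplex.ExactAt.of_isZero hN⟩

lemma exists_coresolution_of_finiteCoresolution (d : ℕ) {M : A}
    (h : finiteCoresolution V V d M) :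
    ∃ Y : Coresolution V M, ∀ n, d < n → IsZero (Y.complex.X n) := by
  induction d generalizing M with
  | zero =>
    obtain ⟨Z, hZ⟩ := HasZeroObject.zero (C := A)
    obtain ⟨f, g, w, e⟩ := isExtension_id M hZ
    refine ⟨(zeroCoresolution.{w} V hZ).cons e h, fun n hn => ?_⟩
    obtain ⟨n, rfl⟩ := Nat.exists_eq_succ_of_ne_zero hn.ne'
    exact hZ
  | succ d ih =>
    obtain ⟨M', h', X, hX, f, g, w, e⟩ := h
    obtain ⟨Y, hY⟩ := ih h'
    refine ⟨Y.cons e hX, fun n hn => ?_⟩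
    obtain ⟨n, rfl⟩ := Nat.exists_eq_succ_of_ne_zero (Nat.ne_zero_of_lt hn)
    exact hY n (by omega)

lemma injDim_lt_top_of_finiteCoresolution (d : ℕ) {M : A} (h : finiteCoresolution V V d M) :
    injDim V M < ⊤ := by
  obtain ⟨Y, hY⟩ := exists_coresolution_of_finiteCoresolution.{w} d h
  refine (iInf_le _ Y).trans_lt (lt_of_le_of_lt (b := (d : ℕ∞)) ?_ (ENat.natCast_lt_top d))
  refine iSup₂_le fun n hn => Nat.cast_le.2 ?_
  by_contra h
  exact hn (hY n (by omega))

lemma leftPerp_of_finiteCoresolution {W : ObjectProperty A} (hW : W ≤ leftPerp.{w} V) (d : ℕ)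
    {M : A} (h : finiteCoresolution V W d M) : leftPerp.{w} V M := by
  induction d generalizing M with
  | zero => exact hW _ h
  | succ d ih =>
    obtain ⟨M', h', X, hX, e⟩ := h
    exact leftPerp.of_left e (IsSelfOrthogonal.leftPerp hX) (ih h')

/-- Apply the horseshoe lemma `d` times, continuing `X₃` by cycles; what remains is an extension of
two cycles. -/
lemma finiteCoresolution_isTateCycle_of_extension (d : ℕ) {X₁ X₂ X₃ : A}
    (h : IsExtension X₁ X₂ X₃) (h₁ : finiteCoresolution V (IsTateCycle V) d X₁)
    (h₃ : IsTateCycle V X₃) : finiteCoresolution V (IsTateCycle V) d X₂ := by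
  induction d generalizing X₁ X₂ X₃ with
  | zero => exact IsTateCycle.of_extension.{w} h h₁ h₃
  | succ d ih =>
    obtain ⟨Y₁, hY₁, e₁⟩ := h₁
    obtain ⟨Y₃, hY₃, e₃⟩ := IsTateCycle.exists_up.{w} h₃
    obtain ⟨Y₂, e₂, e⟩ := exists_horseshoe_up.{w} h e₁ e₃ h₃.leftPerp
    exact ⟨Y₂, ih e hY₁ hY₃, e₂⟩

/-- An object with a finite coresolution by cycles of totally `V`-acyclic complexes has a finite
coresolution by objects of `V` and a single such cycle. -/
lemma finiteCoresolution_of_finiteCoresolution_isTateCycle (d : ℕ) {M : A}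
    (h : finiteCoresolution (IsTateCycle V) (IsTateCycle V) d M) :
    finiteCoresolution V (IsTateCycle V) d M := by
  induction d generalizing M with
  | zero => exact h
  | succ d ih =>
    obtain ⟨M', h', G, hG, f, g, w, e⟩ := h
    obtain ⟨G', hG', X, hX, f', g', w', e'⟩ := IsTateCycle.exists_up.{w} hG
    obtain ⟨Z, hZ⟩ := HasZeroObject.zero (C := A)
    obtain ⟨i, p, wi, ei⟩ := isExtension_id M hZ
    have e₀ : (ShortComplex.mk (0 : Z ⟶ G') (𝟙 G') zero_comp).ShortExact :=
      { exact := (ShortComplex.exact_iff_mono _ rfl).2 (inferInstanceAs (Mono (𝟙 G')))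
        epi_g := inferInstanceAs (Epi (𝟙 G'))
        mono_f := ⟨fun _ _ _ => hZ.eq_of_tgt _ _⟩ }
    have : IsIso i := ei.isIso_f_iff.2 hZ
    -- Compose the monomorphisms `M → G → X`: the cokernel `Q` of `M → X` is an extension of `G'` by
    -- `M'`. The zero object `Z` serves to write this as a morphism of short exact sequences.
    obtain ⟨Q, hQ, hQ'⟩ := exists_cokernel_extension ei e'
      { τ₁ := f
        τ₂ := inv i ≫ f ≫ f'
        τ₃ := 0
        comm₁₂ := by simp
        comm₂₃ := by simp [w'] } e e₀
    exact ⟨Q, finiteCoresolution_isTateCycle_of_extension.{w} d hQ' (ih h') hG', X, hX, hQ⟩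

end Coresolution

end Abelian

end RelativeTate

namespace RelativeTate

section Abelian

variable {A : Type u₁} [Category.{v₁} A] [Abelian A]

/-! ### Existence of Tate coresolutions. -/

section TateExistence

variable {V : ObjectProperty A}

/-- The truncation in degrees `≥ k` of a totally acyclic complex, as a coresolution of the cycles
in degree `k`. -/
noncomputable def IsTotallyAcyclic.coresolution {S : CochainComplex A ℤ} (hS : IsTotallyAcyclic V S)
    (k : ℤ) {G : A} (e : G ≅ S.cycles (k + (0 : ℕ))) : Coresolution V G where
  complex := S.restriction (ComplexShape.embeddingUpIntGE k)
  ι := e.hom ≫ S.iCycles (k + (0 : ℕ))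
  ι_d := by
    change (e.hom ≫ S.iCycles (k + (0 : ℕ))) ≫ S.d (k + (0 : ℕ)) (k + (1 : ℕ)) = 0
    simp
  mem n := hS.mem _
  exact := by
    refine (acyclic_augment_iff _ _ _).2 ⟨mono_comp e.hom (S.iCycles (k + (0 : ℕ))), ?_, fun n => ?_⟩
    · let φ : ShortComplex.mk (e.hom ≫ S.iCycles (k + (0 : ℕ)))
          (S.d (k + (0 : ℕ)) (k + (1 : ℕ))) (by simp) ⟶
        ShortComplex.mk (S.iCycles (k + (0 : ℕ))) (S.d (k + (0 : ℕ)) (k + (1 : ℕ))) (by simp) :=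
        { τ₁ := e.hom, τ₂ := 𝟙 _, τ₃ := 𝟙 _ }
      have : Epi φ.τ₁ := inferInstanceAs (Epi e.hom)
      have : IsIso φ.τ₂ := inferInstanceAs (IsIso (𝟙 _))
      have : Mono φ.τ₃ := inferInstanceAs (Mono (𝟙 _))
      exact (ShortComplex.exact_iff_of_epi_of_isIso_of_mono φ).2
        (ShortComplex.exact_of_f_is_kernel _ (S.cyclesIsKernel _ _ (by simp)))
    · exact (exactAt_succ_iff _ _).2 ((S.exactAt_iff' (k + (n : ℕ)) (k + (n + 1 : ℕ))
        (k + (n + 2 : ℕ)) (by simp; omega) (by simp; omega)).1 (hS.exact _))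

lemma IsTotallyAcyclic.isProper_coresolution {S : CochainComplex A ℤ} (hS : IsTotallyAcyclic V S)
    (k : ℤ) {G : A} (e : G ≅ S.cycles (k + (0 : ℕ))) : (hS.coresolution k e).IsProper := by
  refine (isHomToExact_augment_iff _ _ _ _).2 ⟨fun W hW a => ?_, fun W hW =>
    ⟨fun (b : S.X (k + (0 : ℕ)) ⟶ W) hb => ?_, fun n b hb => ?_⟩⟩
  · obtain ⟨u, hu⟩ := hS.extendsAlong _ W hW (e.inv ≫ a)
    refine ⟨u, ?_⟩
    change (e.hom ≫ S.iCycles (k + (0 : ℕ))) ≫ u = a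
    rw [Category.assoc, hu, e.hom_inv_id_assoc]
  · refine (exactAt_homTo_iff S W (i := k - 1) (j := k + (0 : ℕ)) (k := k + (1 : ℕ))
      (by simp) (by simp)).1 (hS.homTo_exact W hW _) b ?_
    have hb' : (e.hom ≫ S.iCycles (k + (0 : ℕ))) ≫ b = 0 := hb
    rw [Category.assoc] at hb'
    have hb'' : S.iCycles (k + (0 : ℕ)) ≫ b = 0 := by
      rw [← cancel_epi e.hom, comp_zero]
      exact hb'
    rw [← S.toCycles_i, Category.assoc, hb'', comp_zero]
  · exact (exactAt_homTo_iff S W (i := k + (n : ℕ)) (j := k + (n + 1 : ℕ)) (k := k + (n + 2 : ℕ))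
      (by simp; omega) (by simp; omega)).1 (hS.homTo_exact W hW _) b hb

/-- A Tate coresolution in which the comparison morphism has degree `k`. -/
structure ShiftedTateCoresolution (V : ObjectProperty A) (k : ℤ) (N : A) where
  Y : Coresolution V N
  proper : Y.IsProper
  S : CochainComplex A ℤ
  totallyAcyclic : IsTotallyAcyclic V S
  β : ∀ (n : ℕ) (m : ℤ), n + k = m → (Y.complex.X n ⟶ S.X m)
  β_d : ∀ (n : ℕ) (m m' : ℤ) (h : n + k = m) (h' : (n + 1 : ℕ) + k = m'),
    β n m h ≫ S.d m m' = Y.complex.d n (n + 1) ≫ β (n + 1) m' h'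
  isIso_β : ∃ n₀ : ℕ, ∀ n, n₀ ≤ n → ∀ m h, IsIso (β n m h)

lemma nonempty_shiftedTateCoresolution_of_isTateCycle {G : A} (hG : IsTateCycle V G) (k : ℤ) :
    Nonempty (ShiftedTateCoresolution V k G) := by
  obtain ⟨S, hS, ⟨e⟩⟩ := hG (k + (0 : ℕ))
  exact ⟨{
    Y := hS.coresolution k e
    proper := hS.isProper_coresolution k e
    S := S
    totallyAcyclic := hS
    β := fun n m h => (S.XIsoOfEq (by omega : k + (n : ℕ) = m)).hom
    β_d := fun n m m' h h' => (S.XIsoOfEq_hom_comp_d _ _).trans (S.d_comp_XIsoOfEq_hom _ _).symm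
    isIso_β := ⟨0, fun n _ m h =>
      Iso.isIso_hom (S.XIsoOfEq (by omega : k + (n : ℕ) = m))⟩ }⟩

/-- The composite `X → N → Y⁰ → Sᵏ⁺¹` is a cocycle, so `Hom(V, -)`-exactness of `S` lifts it to `X →
Sᵏ`. The new first term moves `Y` one degree to the right and so lowers the degree of the comparison
by one. -/
lemma ShiftedTateCoresolution.cons {k : ℤ} {M X N : A} (T : ShiftedTateCoresolution V (k + 1) N)
    {f : M ⟶ X} {g : X ⟶ N} {w : f ≫ g = 0} (h : (ShortComplex.mk f g w).ShortExact) (hX : V X)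
    (hf : ExtendsAlong V f) : Nonempty (ShiftedTateCoresolution V k M) := by
  have hlift : ∀ m : ℤ, k = m → ∃ b : X ⟶ T.S.X m, ∀ m' (h : (0 : ℕ) + (k + 1) = m'),
      b ≫ T.S.d m m' = (g ≫ T.Y.ι) ≫ T.β 0 m' h := by
    rintro _ rfl
    obtain ⟨b, hb⟩ := (exactAt_homFrom_iff T.S X (i := k) (j := k + 1) (k := k + 1 + 1)
      (by simp) (by simp)).1 (T.totallyAcyclic.homFrom_exact X hX (k + 1))
      ((g ≫ T.Y.ι) ≫ T.β 0 (k + 1) (by simp)) (by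
        rw [Category.assoc, T.β_d 0 (k + 1) (k + 1 + 1) (by simp) (by push_cast; omega),
          Category.assoc, reassoc_of% T.Y.ι_d, zero_comp, comp_zero])
    refine ⟨b, fun m' h => ?_⟩
    obtain rfl : k + 1 = m' := by simpa using h
    exact hb
  choose b hb using hlift
  obtain ⟨n₀, hn₀⟩ := T.isIso_β
  exact ⟨{
    Y := T.Y.cons h hX
    proper := T.proper.cons h hX hf
    S := T.S
    totallyAcyclic := T.totallyAcyclic
    β := fun n => match n with
      | 0 => fun m h => b m (by simpa using h)
      | n + 1 => fun m h => T.β n m (by push_cast at h; omega)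
    β_d := fun n => match n with
      | 0 => fun m m' h h' => hb m (by simpa using h) m' (by push_cast at h' ⊢; omega)
      | n + 1 => fun m m' h h' => T.β_d n m m' (by push_cast at h; omega)
          (by push_cast at h' ⊢; omega)
    isIso_β := ⟨n₀ + 1, fun n => match n with
      | 0 => fun hn => by omega
      | n + 1 => fun hn m h => hn₀ n (by omega) m (by push_cast at h; omega)⟩ }⟩

/-- A coresolution, extended by zero to all degrees, coincides with the given one in degrees
`n ≥ 0`. -/
noncomputable def Coresolution.extendXIso {N : A} (Y : Coresolution V N) (n : ℕ) :
    (Y.complex.extend ComplexShape.embeddingUpNat).X n ≅ Y.complex.X n :=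
  Y.complex.extendXIso ComplexShape.embeddingUpNat (i := n) (i' := n) rfl

lemma Coresolution.extendXIso_hom_d {N : A} (Y : Coresolution V N) (n : ℕ) :
    (Y.extendXIso n).hom ≫ Y.complex.d n (n + 1) =
      (Y.complex.extend ComplexShape.embeddingUpNat).d n (n + 1 : ℕ) ≫
        (Y.extendXIso (n + 1)).hom := by
  rw [Y.complex.extend_d_eq ComplexShape.embeddingUpNat (i := n) (j := n + 1) (i' := n)
    (j' := (n + 1 : ℕ)) rfl rfl]
  simp [extendXIso]

/-- The Tate coresolution given by a comparison morphism of degree zero. -/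
noncomputable def ShiftedTateCoresolution.toTateCoresolution {N : A}
    (T : ShiftedTateCoresolution V 0 N) : TateCoresolution V N where
  Y := T.Y
  proper := T.proper
  S := T.S
  totallyAcyclic := T.totallyAcyclic
  β :=
    { f := fun m => match m with
        | .ofNat n => (T.Y.extendXIso n).hom ≫ T.β n n (add_zero _)
        | .negSucc n => 0
      comm' := by
        rintro (n | n) m rfl
        · change ((T.Y.extendXIso n).hom ≫ T.β n n (add_zero _)) ≫ T.S.d n (n + 1 : ℕ) =
            (T.Y.complex.extend ComplexShape.embeddingUpNat).d n (n + 1 : ℕ) ≫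
              (T.Y.extendXIso (n + 1)).hom ≫ T.β (n + 1) (n + 1 : ℕ) (add_zero _)
          rw [← reassoc_of% T.Y.extendXIso_hom_d n, Category.assoc,
            T.β_d n n (n + 1 : ℕ) (add_zero _) (add_zero _)]
        · exact (T.Y.complex.isZero_extend_X ComplexShape.embeddingUpNat _
            (fun i (h : Int.ofNat i = Int.negSucc n) => by cases h)).eq_of_src _ _ }
  isIso_β := by
    obtain ⟨n₀, hn₀⟩ := T.isIso_β
    refine ⟨n₀, fun n hn => ?_⟩
    obtain ⟨n, rfl⟩ := Int.eq_ofNat_of_zero_le (le_trans (by simp) hn)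
    have := hn₀ n (by simpa using hn) n (add_zero _)
    exact inferInstanceAs (IsIso ((T.Y.extendXIso n).hom ≫ T.β n n (add_zero _)))

variable [HasExt.{w} A] [IsSelfOrthogonal.{w} V]

/-- The degree `k` must be arbitrary for the induction: removing the first term of the coresolution
raises it by one. -/
lemma nonempty_shiftedTateCoresolution (d : ℕ) {M : A}
    (h : finiteCoresolution V (IsTateCycle V) d M) (k : ℤ) :
    Nonempty (ShiftedTateCoresolution V k M) := by
  induction d generalizing M k with
  | zero => exact nonempty_shiftedTateCoresolution_of_isTateCycle h k
  | succ d ih =>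
    obtain ⟨M', h', X, hX, f, g, w, e⟩ := h
    obtain ⟨T⟩ := ih h' (k + 1)
    exact T.cons e hX ((leftPerp_of_finiteCoresolution.{w}
      (fun _ hG => IsTateCycle.leftPerp hG) d h').extendsAlong e)

lemma hasTateCoresolution_of_isTateCycle {G : A} (hG : IsTateCycle V G) :
    HasTateCoresolution V G :=
  let ⟨T⟩ := nonempty_shiftedTateCoresolution_of_isTateCycle hG 0
  ⟨T.toTateCoresolution⟩

/-- An object of finite `𝒢(V)`-injective dimension admits a Tate `V`-coresolution. -/
theorem hasTateCoresolution_of_injDim_gorenstein {M : A} (hM : injDim (gorenstein V) M < ⊤) :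
    HasTateCoresolution V M := by
  obtain ⟨d, hd⟩ := exists_finiteCoresolution_of_injDim_lt_top
    (fun {X Y} e ⟨S, hS, ⟨e'⟩⟩ => ⟨S, hS, ⟨e.symm ≪≫ e'⟩⟩) hM
  obtain ⟨T⟩ := nonempty_shiftedTateCoresolution.{w} d
    (finiteCoresolution_of_finiteCoresolution_isTateCycle.{w} d
      (finiteCoresolution_mono (fun _ h => isTateCycle_of_gorenstein.{w} h)
        (fun _ h => isTateCycle_of_gorenstein.{w} h) d _ hd)) 0
  exact ⟨T.toTateCoresolution⟩

end TateExistence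

end Abelian

end RelativeTate

namespace RelativeTate

section Abelian

variable {A : Type u₁} [Category.{v₁} A] [Abelian A]

/-! ### Vanishing of Tate cohomology. -/

section TateVanishing

variable {V : ObjectProperty A}

namespace TateCoresolution

variable {N : A} (T : TateCoresolution V N)

/-- The comparison morphism in degree `n ≥ 0`. -/
noncomputable def hom (n : ℕ) : T.Y.complex.X n ⟶ T.S.X n := (T.Y.extendXIso n).inv ≫ T.β.f n

lemma hom_d (n : ℕ) :
    T.hom n ≫ T.S.d n (n + 1 : ℕ) = T.Y.complex.d n (n + 1) ≫ T.hom (n + 1) := by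
  rw [← cancel_epi (T.Y.extendXIso n).hom, reassoc_of% T.Y.extendXIso_hom_d n]
  simp [hom]

/-- The comparison morphism between the cycles in degree `n ≥ 0`. -/
noncomputable def cyclesHom (n : ℕ) : T.Y.complex.cycles n ⟶ T.S.cycles n :=
  T.S.liftCycles (T.Y.complex.iCycles n ≫ T.hom n) (n + 1 : ℕ) (by simp)
    (by rw [Category.assoc, T.hom_d]; simp)

@[simp]
lemma cyclesHom_iCycles (n : ℕ) :
    T.cyclesHom n ≫ T.S.iCycles n = T.Y.complex.iCycles n ≫ T.hom n := by
  simp [cyclesHom]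

/-- The comparison morphism between the sequences of cycles. -/
noncomputable def cyclesSequenceHom (n : ℕ) :
    cyclesSequence T.Y.complex n (n + 1) ⟶ cyclesSequence T.S n (n + 1 : ℕ) where
  τ₁ := T.cyclesHom n
  τ₂ := T.hom n
  τ₃ := T.cyclesHom (n + 1)
  comm₁₂ := T.cyclesHom_iCycles n
  comm₂₃ := by
    change T.hom n ≫ T.S.toCycles n (n + 1 : ℕ) =
      T.Y.complex.toCycles n (n + 1) ≫ T.cyclesHom (n + 1)
    rw [← cancel_mono (T.S.iCycles (n + 1 : ℕ)), Category.assoc, Category.assoc,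
      T.S.toCycles_i, T.hom_d, T.cyclesHom_iCycles, ← Category.assoc, T.Y.complex.toCycles_i]

/-- Cycles in degree `n` depend only on the terms in degrees `n` and `n + 1`, both of which are
eventually compared by isomorphisms. -/
lemma isIso_cyclesHom : ∃ n₀ : ℕ, ∀ n, n₀ ≤ n → IsIso (T.cyclesHom n) := by
  obtain ⟨m, hm⟩ := T.isIso_β
  have h : ∀ n : ℕ, m.toNat ≤ n → IsIso (T.hom n) := fun n hn => by
    have := hm n (by omega)
    exact inferInstanceAs (IsIso ((T.Y.extendXIso n).inv ≫ T.β.f n))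
  refine ⟨m.toNat, fun n hn => ?_⟩
  have h₁ := h n hn
  have h₂ := h (n + 1) (by omega)
  refine ⟨T.Y.complex.liftCycles (T.S.iCycles n ≫ inv (T.hom n)) (n + 1) (by simp) ?_, ?_, ?_⟩
  · rw [← cancel_mono (T.hom (n + 1)), Category.assoc, Category.assoc, ← T.hom_d]
    simp
  · simp [← cancel_mono (T.Y.complex.iCycles n), reassoc_of% T.cyclesHom_iCycles n]
  · simp [← cancel_mono (T.S.iCycles n)]

end TateCoresolution

section

variable {S : CochainComplex A ℤ} (hS : IsTotallyAcyclic V S)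

include hS

/-- Cocycles are morphisms `L ⟶ Zⁿ`, and coboundaries are those that lift to `Sⁿ⁻¹`. A morphism
through `W` in `V` lifts because `Hom(W, S)` is exact, and a lift is itself a factorization through
`Sⁿ⁻¹`. -/
lemma IsTotallyAcyclic.isZero_homology_iff (n : ℤ) (L : A) :
    IsZero ((homFrom L S).homology n) ↔ ∀ f : L ⟶ S.cycles n, FactorsThrough V f := by
  have hn : n - 1 + 1 = n := sub_add_cancel n 1
  rw [← HomologicalComplex.exactAt_iff_isZero_homology,
    exactAt_homFrom_iff S L (i := n - 1) (k := n + 1) (by simp) (by simp)]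
  constructor
  · intro h f
    obtain ⟨g, hg⟩ := h (f ≫ S.iCycles n) (by simp)
    refine ⟨_, g, S.toCycles (n - 1) n, hS.mem _, ?_⟩
    rw [← cancel_mono (S.iCycles n), Category.assoc, S.toCycles_i, hg]
  · intro h f hf
    obtain ⟨W, a, b, hW, hab⟩ := h (S.liftCycles f (n + 1) (by simp) hf)
    obtain ⟨u, rfl⟩ := hS.liftsAlong hn W hW b
    refine ⟨a ≫ u, ?_⟩
    rw [← S.toCycles_i, Category.assoc, reassoc_of% hab, S.liftCycles_i]

lemma IsTotallyAcyclic.factorsThrough_id_iff (n m : ℤ) :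
    FactorsThrough V (𝟙 (S.cycles n)) ↔ FactorsThrough V (𝟙 (S.cycles m)) := by
  have key : ∀ k, FactorsThrough V (𝟙 (S.cycles k)) ↔ FactorsThrough V (𝟙 (S.cycles (k + 1))) :=
    fun k =>
      have h := hS.shortExact (rfl : k + 1 = k + 1)
      ⟨fun h' => FactorsThrough.τ₃ h (𝟙 (cyclesSequence S k (k + 1))) (hS.mem k)
        (hS.extendsAlong k) h', fun h' => FactorsThrough.τ₁ h (𝟙 (cyclesSequence S k (k + 1)))
        (hS.mem k) (hS.liftsAlong rfl) h'⟩
  induction m using Int.inductionOn' (b := n) with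
  | zero => rfl
  | succ k _ ih => exact ih.trans (key k)
  | pred k _ ih => exact ih.trans (by rw [key (k - 1), sub_add_cancel])

end

lemma isZero_tateExt_iff (n : ℤ) (M N : A) (hN : HasTateCoresolution V N) :
    IsZero (tateExt V n M N hN) ↔
      ∀ f : M ⟶ (Classical.choice hN).S.cycles n, FactorsThrough V f :=
  (Classical.choice hN).totallyAcyclic.isZero_homology_iff n M

variable [HasExt.{w} A] [IsSelfOrthogonal.{w} V]

open Abelian

lemma finiteCoresolution_of_iso (d : ℕ) {M N : A} (e : M ≅ N) (h : finiteCoresolution V V d M) :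
    finiteCoresolution V V d N := by
  cases d with
  | zero => exact IsSelfOrthogonal.of_iso.{w} (V := V) e h
  | succ d =>
    obtain ⟨M', h', X, hX, e'⟩ := h
    exact ⟨M', h', X, hX, e'.of_iso e (Iso.refl _)⟩

lemma finiteCoresolution_of_prop_cycles {M : A} (Y : Coresolution V M) (n : ℕ)
    (h : V (Y.complex.cycles n)) : finiteCoresolution V V n M := by
  have key : ∀ i j, i + j = n → finiteCoresolution V V i (Y.complex.cycles j) := fun i => by
    induction i with
    | zero =>
      intro j hj
      obtain rfl : j = n := by omega
      exact h
    | succ i ih =>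
      intro j hj
      exact ⟨_, ih (j + 1) (by omega), _, Y.mem j, IsExtension.of_shortExact (Y.shortExact j)⟩
  exact finiteCoresolution_of_iso.{w} n Y.isoCycles.symm (key n 0 (by simp))

lemma subsingleton_ext_of_finiteCoresolution {G : A} (hG : leftPerp.{w} V G) (d : ℕ) {M : A}
    (h : finiteCoresolution V V d M) (i : ℕ) (hi : d ≤ i) : Subsingleton (Ext.{w} G M (i + 1)) := by
  induction d generalizing M i with
  | zero => exact hG M h i
  | succ d ih =>
    obtain ⟨M', h', X, hX, f, g, w, e⟩ := h
    obtain ⟨i, rfl⟩ := Nat.exists_eq_succ_of_ne_zero (Nat.ne_zero_of_lt hi)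
    have := ih h' i (by omega)
    have := hG X hX (i + 1)
    exact subsingleton_ext_X₁_right e G rfl

/-- Each step along `Y` lowers the Ext degree by one, since `G` is orthogonal to the terms of `Y`.
Here `Y` is arbitrary and need not be the finite coresolution that bounds the Ext groups of `M`. -/
lemma subsingleton_ext_cycles {G : A} (hG : leftPerp.{w} V G) (d : ℕ) {M : A}
    (h : finiteCoresolution V V d M) (Y : Coresolution V M) (n : ℕ) (i : ℕ) (hi : d ≤ i + n) :
    Subsingleton (Ext.{w} G (Y.complex.cycles n) (i + 1)) := by
  induction n generalizing i with
  | zero =>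
    exact subsingleton_ext_of_finiteCoresolution hG d
      (finiteCoresolution_of_iso.{w} d Y.isoCycles h) i hi
  | succ n ih =>
    have := ih (i + 1) (by omega)
    have := hG _ (Y.mem n) i
    exact subsingleton_ext_X₃_right (Y.shortExact n) G rfl

/-- The totally acyclic complex in a Tate coresolution of an object of finite `V`-injective
dimension is contractible. -/
lemma TateCoresolution.factorsThrough_id {M : A} (T : TateCoresolution V M) (d : ℕ)
    (h : finiteCoresolution V V d M) (n : ℤ) : FactorsThrough V (𝟙 (T.S.cycles n)) := by
  obtain ⟨n₀, hn₀⟩ := T.isIso_cyclesHom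
  -- Beyond `n₀` the cycles of `Y` and `S` agree; beyond `d` one has `Ext¹(Zᵐ⁺¹(S), Zᵐ(Y)) = 0`.
  -- Hence `Zᵐ(S)` is a retract of `Sᵐ`.
  let m := max n₀ d
  rw [T.totallyAcyclic.factorsThrough_id_iff n m]
  have := hn₀ m (le_max_left _ _)
  have hS := T.totallyAcyclic.shortExact (rfl : (m : ℤ) + 1 = m + 1)
  have : Subsingleton (Ext.{w} (cyclesSequence T.S m (m + 1)).X₃ (T.Y.complex.cycles m) 1) :=
    subsingleton_ext_cycles (T.totallyAcyclic.leftPerp_cycles _) d h T.Y m 0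
      (by simp only [Nat.zero_add]; exact le_max_right _ _)
  obtain ⟨g, hg⟩ := exists_extension_of_subsingleton_ext hS (inv (T.cyclesHom m))
  exact ⟨_, T.S.iCycles m, g ≫ T.cyclesHom m, T.totallyAcyclic.mem _, by
    rw [← Category.assoc]
    exact (congrArg (· ≫ T.cyclesHom m) hg).trans (IsIso.inv_hom_id _)⟩

/-- Extend `f` to `X ⟶ Sⁿ`, which induces `M' ⟶ Zⁿ⁺¹`. This factors by induction, and
`FactorsThrough.τ₁` brings the factorization back to `f`. -/
lemma IsTotallyAcyclic.factorsThrough_of_finiteCoresolution {S : CochainComplex A ℤ}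
    (hS : IsTotallyAcyclic V S) (d : ℕ) {M : A} (h : finiteCoresolution V V d M) (n : ℤ)
    (f : M ⟶ S.cycles n) : FactorsThrough V f := by
  induction d generalizing M n with
  | zero => exact ⟨M, 𝟙 M, f, h, Category.id_comp f⟩
  | succ d ih =>
    obtain ⟨M', h', X, hX, i, p, w, e⟩ := h
    have hM' : leftPerp.{w} V M' := leftPerp_of_finiteCoresolution
      (fun _ h => IsSelfOrthogonal.leftPerp h) d h'
    obtain ⟨u, hu⟩ := hM'.extendsAlong e _ (hS.mem n) (f ≫ S.iCycles n)
    have hp := e.epi_g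
    have hu' : i ≫ u ≫ S.toCycles n (n + 1) = 0 := by
      rw [reassoc_of% hu, (cyclesSequence S n (n + 1)).zero, comp_zero]
    let φ : ShortComplex.mk i p w ⟶ cyclesSequence S n (n + 1) :=
      { τ₁ := f
        τ₂ := u
        τ₃ := e.exact.desc (u ≫ S.toCycles n (n + 1)) hu'
        comm₁₂ := hu.symm
        comm₂₃ := (e.exact.g_desc _ hu').symm }
    exact FactorsThrough.τ₁ (hS.shortExact rfl) φ hX (hS.liftsAlong rfl) (ih h' (n + 1) φ.τ₃)

lemma TateCoresolution.finiteCoresolution {M : A} (T : TateCoresolution V M) {n : ℤ}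
    (h : FactorsThrough V (𝟙 (T.S.cycles n))) : ∃ d, finiteCoresolution V V d M := by
  obtain ⟨n₀, hn₀⟩ := T.isIso_cyclesHom
  have := hn₀ n₀ le_rfl
  rw [T.totallyAcyclic.factorsThrough_id_iff n n₀] at h
  exact ⟨n₀, finiteCoresolution_of_prop_cycles.{w} T.Y n₀
    (IsSelfOrthogonal.of_iso.{w} (asIso (T.cyclesHom n₀)).symm (FactorsThrough.prop.{w} h))⟩

/-- The comparison `Z⁰(Y) ⟶ Z⁰(S)` factors through `V`, and `FactorsThrough.τ₃` carries this to all
later cycles, where the comparison is eventually invertible. -/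
lemma TateCoresolution.exists_factorsThrough_id {M : A} (T : TateCoresolution V M)
    (h : ∀ f : M ⟶ T.S.cycles 0, FactorsThrough V f) :
    ∃ n : ℤ, FactorsThrough V (𝟙 (T.S.cycles n)) := by
  have key : ∀ n, FactorsThrough V (T.cyclesHom n) := fun n => by
    induction n with
    | zero =>
      have := (h (T.Y.isoCycles.hom ≫ T.cyclesHom 0)).comp_left T.Y.isoCycles.inv
      rwa [Iso.inv_hom_id_assoc] at this
    | succ n ih =>
      exact FactorsThrough.τ₃ (T.Y.shortExact n) (T.cyclesSequenceHom n)
        (T.totallyAcyclic.mem _) (T.proper.extendsAlong n) ih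
  obtain ⟨n₀, hn₀⟩ := T.isIso_cyclesHom
  have := hn₀ n₀ le_rfl
  refine ⟨n₀, ?_⟩
  rw [← IsIso.inv_hom_id (T.cyclesHom n₀)]
  exact (key n₀).comp_left _

/-- The cycles of a totally acyclic complex are stable retracts of the cycles of the totally
acyclic complex in a Tate coresolution of one of them. -/
lemma IsTotallyAcyclic.isStableRetract {S : CochainComplex A ℤ} (hS : IsTotallyAcyclic V S)
    (a : ℤ) (T : TateCoresolution V (S.cycles a)) (n : ℤ) (b : ℤ) (h : a + n = b) :
    IsStableRetract V (S.cycles b) (T.S.cycles n) := by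
  -- `T.S` need not be a shift of `S`. The two are compared by climbing along `Y` until it agrees
  -- with `T.S`, and then moving in both directions along `S` and `T.S`.
  have hup : ∀ n : ℕ, ∀ b, a + n = b → IsStableRetract V (S.cycles b) (T.Y.complex.cycles n) :=
    fun n => by
      induction n with
      | zero =>
        intro b hb
        obtain rfl : a = b := by simpa using hb
        exact IsStableRetract.of_iso.{w} T.Y.isoCycles
      | succ n ih =>
        intro b hb
        have hb' : a + n + 1 = b := by rw [← hb]; push_cast; ring
        exact IsStableRetract.up (hS.shortExact hb') (T.Y.shortExact n) (hS.mem _) (T.Y.mem n)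
          (hS.extendsAlong _) (T.proper.extendsAlong n) (ih _ rfl)
  obtain ⟨n₀, hn₀⟩ := T.isIso_cyclesHom
  have := hn₀ n₀ le_rfl
  have h₀ : ∀ b, a + n₀ = b → IsStableRetract V (S.cycles b) (T.S.cycles n₀) := fun b hb =>
    (hup n₀ b hb).of_iso_right (asIso (T.cyclesHom n₀))
  revert b
  induction n using Int.inductionOn' (b := (n₀ : ℤ)) with
  | zero => exact h₀
  | succ k _ ih =>
    intro b hb
    have hb' : a + k + 1 = b := by rw [← hb]; ring
    exact IsStableRetract.up (hS.shortExact hb') (T.totallyAcyclic.shortExact rfl) (hS.mem _)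
      (T.totallyAcyclic.mem _) (hS.extendsAlong _) (T.totallyAcyclic.extendsAlong _) (ih _ rfl)
  | pred k _ ih =>
    intro b hb
    have hb' : b + 1 = a + k := by rw [← hb]; ring
    exact IsStableRetract.down (hS.shortExact hb')
      (T.totallyAcyclic.shortExact (sub_add_cancel k 1)) (hS.mem _) (T.totallyAcyclic.mem _)
      (hS.liftsAlong hb') (T.totallyAcyclic.liftsAlong (sub_add_cancel k 1)) (ih _ rfl)

/-- The characterization of finite `V`-injective dimension by the vanishing of Tate cohomology. -/
theorem tfae_injDim_lt_top {M : A} (hT : HasTateCoresolution V M) :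
    List.TFAE [
      injDim V M < ⊤,
      ∀ n : ℤ, ∀ (N : A) (hN : HasTateCoresolution V N), IsZero (tateExt V n M N hN),
      ∃ n : ℤ, ∀ (N : A) (hN : HasTateCoresolution V N), IsZero (tateExt V n M N hN),
      ∀ n : ℤ, ∀ N : A, IsZero (tateExt V n N M hT),
      ∃ n : ℤ, ∀ N : A, IsZero (tateExt V n N M hT),
      IsZero (tateExt V 0 M M hT)] := by
  simp only [isZero_tateExt_iff]
  let T := Classical.choice hT
  have hV : injDim V M < ⊤ → ∃ d, finiteCoresolution V V d M :=
    exists_finiteCoresolution_of_injDim_lt_top fun e => IsSelfOrthogonal.of_iso.{w} e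
  tfae_have 1 → 2 := fun h n N hN f => by
    obtain ⟨d, hd⟩ := hV h
    exact (Classical.choice hN).totallyAcyclic.factorsThrough_of_finiteCoresolution.{w} d hd n f
  tfae_have 2 → 3 := fun h => ⟨0, h 0⟩
  -- The test object is `Z⁻ⁿ(S)`: up to stable retracts, the degree `n` cycles of its chosen Tate
  -- coresolution contain `Z⁰(S)`.
  tfae_have 3 → 6 := fun ⟨n, h⟩ f => by
    have hS := T.totallyAcyclic
    have hN := hasTateCoresolution_of_isTateCycle (hS.isTateCycle.{w} (-n))
    exact (hS.isStableRetract.{w} (-n) (Classical.choice hN) n 0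
      (neg_add_cancel n)).factorsThrough.{w} (h _ hN) f
  tfae_have 6 → 1 := fun h => by
    obtain ⟨n, hn⟩ := T.exists_factorsThrough_id h
    obtain ⟨d, hd⟩ := T.finiteCoresolution.{w} hn
    exact injDim_lt_top_of_finiteCoresolution.{w} d hd
  tfae_have 1 → 4 := fun h n N f => by
    obtain ⟨d, hd⟩ := hV h
    simpa using (T.factorsThrough_id.{w} d hd n).comp_left f
  tfae_have 4 → 5 := fun h => ⟨0, h 0⟩
  -- Test on `Zⁿ(S)` and its identity.
  tfae_have 5 → 1 := fun ⟨n, h⟩ => by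
    obtain ⟨d, hd⟩ := T.finiteCoresolution.{w} (h (T.S.cycles n) (𝟙 _))
    exact injDim_lt_top_of_finiteCoresolution.{w} d hd
  tfae_finish

end TateVanishing

end Abelian

end RelativeTate

namespace RelativeTate

/-! ### The tensor evaluation morphism. -/

section TensorEvaluation

open TensorProduct

variable {R : Type u} [CommRing R] (C I K L P : Type u) [AddCommGroup C] [Module R C]
  [AddCommGroup I] [Module R I] [AddCommGroup K] [Module R K] [AddCommGroup L] [Module R L]
  [AddCommGroup P] [Module R P]

/-- The evaluation morphism `K ⊗ Hom(C, I) → Hom(Hom(K, C), I)`. -/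
noncomputable def tensorEval : K ⊗[R] (C →ₗ[R] I) →ₗ[R] ((K →ₗ[R] C) →ₗ[R] I) :=
  TensorProduct.lift
    ((LinearMap.llcomp R (K →ₗ[R] C) C I).flip.comp (LinearMap.id (R := R) (M := K →ₗ[R] C)).flip)

@[simp]
lemma tensorEval_tmul (k : K) (f : C →ₗ[R] I) (g : K →ₗ[R] C) :
    tensorEval C I K (k ⊗ₜ f) g = f (g k) := rfl

variable {K P} in
lemma tensorEval_naturality (a : K →ₗ[R] P) (x : K ⊗[R] (C →ₗ[R] I)) :
    tensorEval C I P (a.rTensor _ x) =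
      (tensorEval C I K x).comp (LinearMap.lcomp R C a) := by
  induction x with
  | zero => simp
  | add x y hx hy => simp [hx, hy, LinearMap.add_comp]
  | tmul k f => ext g; simp

lemma tensorEval_bijective_of_free [Module.Free R P] [Module.Finite R P] :
    Function.Bijective (tensorEval (R := R) C I P) := by
  let b := Module.Free.chooseBasis R P
  -- The inverse is the dual-basis formula: `φ` goes to the sum of `bᵢ ⊗ (c ↦ φ(bᵢ* · c))`, a finite
  -- sum because `P` has finite rank.
  let ψ : ((P →ₗ[R] C) →ₗ[R] I) → P ⊗[R] (C →ₗ[R] I) := fun φ =>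
    ∑ i, b i ⊗ₜ[R] (φ.comp (LinearMap.smulRightₗ (b.coord i)))
  have hψ : ∀ φ φ', ψ (φ + φ') = ψ φ + ψ φ' := fun φ φ' => by
    simp [ψ, LinearMap.add_comp, TensorProduct.tmul_add, Finset.sum_add_distrib]
  refine Function.bijective_iff_has_inverse.2 ⟨ψ, fun x => ?_, fun φ => ?_⟩
  · induction x with
    | zero => simp [ψ]
    | add x y hx hy => rw [map_add, hψ, hx, hy]
    | tmul k f =>
      have : ∀ i, (tensorEval C I P (k ⊗ₜ[R] f)).comp (LinearMap.smulRightₗ (b.coord i)) =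
          b.coord i k • f := fun i => by ext c; simp
      simp only [ψ, this, TensorProduct.tmul_smul, TensorProduct.smul_tmul',
        ← TensorProduct.sum_tmul, Module.Basis.coord_apply, b.sum_repr]
  · ext g
    simp only [ψ, map_sum, LinearMap.sum_apply, tensorEval_tmul, LinearMap.comp_apply]
    rw [← map_sum]
    congr 1
    refine b.ext fun j => ?_
    simp [Finsupp.single_apply, ite_smul]

variable {I}

/-- An injective module turns exact sequences into exact sequences. -/
lemma exact_lcomp_of_injective [Module.Injective R I] {X Y Z : Type u} [AddCommGroup X] [Module R X]
    [AddCommGroup Y] [Module R Y] [AddCommGroup Z] [Module R Z] {f : X →ₗ[R] Y} {g : Y →ₗ[R] Z}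
    (h : Function.Exact f g) : Function.Exact (LinearMap.lcomp R I g) (LinearMap.lcomp R I f) := by
  intro φ
  constructor
  · intro hφ
    have hker : LinearMap.ker g ≤ LinearMap.ker φ := fun y hy => by
      obtain ⟨x, rfl⟩ := (h y).1 hy
      exact LinearMap.congr_fun hφ x
    obtain ⟨ψ, hψ⟩ := Module.Injective.out ((LinearMap.ker g).liftQ g le_rfl)
      (LinearMap.ker_eq_bot.1 (Submodule.ker_liftQ_eq_bot' _ _ rfl))
      ((LinearMap.ker g).liftQ φ hker)
    refine ⟨ψ, LinearMap.ext fun y => ?_⟩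
    simpa using hψ (Submodule.Quotient.mk y)
  · rintro ⟨ψ, rfl⟩
    ext x
    simp [h.apply_apply_eq_zero]

/-- Both `- ⊗ Hom(C, I)` and `Hom(Hom(-, C), I)` are right exact, the latter because `I` is
injective. A diagram chase on `L → P → K → 0` then needs only surjectivity at `L`. -/
lemma tensorEval_bijective_of_exact [Module.Injective R I] {a : L →ₗ[R] P} {b : P →ₗ[R] K}
    (hab : Function.Exact a b) (hb : Function.Surjective b)
    (hL : Function.Surjective (tensorEval (R := R) C I L))
    (hP : Function.Bijective (tensorEval (R := R) C I P)) :
    Function.Bijective (tensorEval (R := R) C I K) := by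
  have hC : Function.Injective (LinearMap.lcomp R C b) := fun f g h => by
    ext k
    obtain ⟨p, rfl⟩ := hb k
    exact LinearMap.congr_fun h p
  have hC' : Function.Exact (LinearMap.lcomp R C b) (LinearMap.lcomp R C a) := by
    intro f
    constructor
    · intro hf
      have hker : LinearMap.ker b ≤ LinearMap.ker f := fun y hy => by
        obtain ⟨x, rfl⟩ := (hab y).1 hy
        exact LinearMap.congr_fun hf x
      let e := b.quotKerEquivOfSurjective hb
      refine ⟨((LinearMap.ker b).liftQ f hker).comp e.symm.toLinearMap, LinearMap.ext fun y => ?_⟩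
      have : e.symm (b y) = Submodule.Quotient.mk y := by
        rw [LinearEquiv.symm_apply_eq]
        rfl
      simp [this]
    · rintro ⟨g, rfl⟩
      ext x
      simp [hab.apply_apply_eq_zero]
  constructor
  · rw [injective_iff_map_eq_zero]
    intro x hx
    obtain ⟨y, rfl⟩ := LinearMap.rTensor_surjective (C →ₗ[R] I) hb x
    rw [tensorEval_naturality] at hx
    obtain ⟨φ, hφ⟩ := (exact_lcomp_of_injective hC' (tensorEval C I P y)).1 hx
    obtain ⟨z, rfl⟩ := hL φ
    have : a.rTensor (C →ₗ[R] I) z = y := hP.1 (by rw [tensorEval_naturality]; exact hφ)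
    rw [← this]
    exact (rTensor_exact (C →ₗ[R] I) hab hb).apply_apply_eq_zero z
  · intro φ
    obtain ⟨φ', hφ'⟩ : ∃ φ', LinearMap.lcomp R I (LinearMap.lcomp R C b) φ' = φ := by
      obtain ⟨ψ, hψ⟩ := Module.Injective.out (LinearMap.lcomp R C b) hC φ
      exact ⟨ψ, LinearMap.ext hψ⟩
    obtain ⟨y, rfl⟩ := hP.2 φ'
    exact ⟨b.rTensor _ y, by rw [tensorEval_naturality]; exact hφ'⟩

variable {C K P}

/-- Tensoring with `Hom(C, I)` preserves an injection along which all morphisms to `C` extend. -/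
lemma rTensor_injective_of_tensorEval [Module.Injective R I] {a : K →ₗ[R] P}
    (ha : ∀ f : K →ₗ[R] C, ∃ g : P →ₗ[R] C, g.comp a = f)
    (hK : Function.Injective (tensorEval (R := R) C I K)) :
    Function.Injective (a.rTensor (C →ₗ[R] I)) := by
  rw [injective_iff_map_eq_zero]
  intro x hx
  apply hK
  ext f
  obtain ⟨g, rfl⟩ := ha f
  have := tensorEval_naturality C I a x
  rw [hx, map_zero] at this
  exact (LinearMap.congr_fun this g).symm.trans (by simp)

end TensorEvaluation

/-! ### Balancing and shifting Tor-vanishing, phrased as injectivity of tensored maps. -/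

section Dimension

open TensorProduct

variable {R : Type u} [CommRing R] {K' P K U' F U : Type u} [AddCommGroup K'] [Module R K']
  [AddCommGroup P] [Module R P] [AddCommGroup K] [Module R K] [AddCommGroup U'] [Module R U']
  [AddCommGroup F] [Module R F] [AddCommGroup U] [Module R U]

/-- If `0 → K' → P → K → 0` remains exact after tensoring with `U`, and `P` is flat, then
`0 → U' → F → U → 0` remains exact after tensoring with `K`. -/
lemma lTensor_injective_of_rTensor_injective [Module.Flat R P] {a : K' →ₗ[R] P} {b : P →ₗ[R] K}
    (hab : Function.Exact a b) (hb : Function.Surjective b) {f : U' →ₗ[R] F} {g : F →ₗ[R] U}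
    (hf : Function.Injective f) (hfg : Function.Exact f g) (hg : Function.Surjective g)
    (hU : Function.Injective (a.rTensor U)) : Function.Injective (f.lTensor K) := by
  rw [injective_iff_map_eq_zero]
  intro x hx
  obtain ⟨y, rfl⟩ := LinearMap.rTensor_surjective U' hb x
  have comm {X X' Y Y' : Type u} [AddCommGroup X] [Module R X] [AddCommGroup X'] [Module R X']
      [AddCommGroup Y] [Module R Y] [AddCommGroup Y'] [Module R Y'] (s : X →ₗ[R] X')
      (t : Y →ₗ[R] Y') (z : X ⊗[R] Y) :
      t.lTensor X' (s.rTensor Y z) = s.rTensor Y' (t.lTensor X z) := by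
    rw [← LinearMap.comp_apply, ← LinearMap.comp_apply, LinearMap.lTensor_comp_rTensor,
      LinearMap.rTensor_comp_lTensor]
  rw [comm] at hx
  obtain ⟨z, hz⟩ := (rTensor_exact F hab hb _).1 hx
  -- Injectivity of `K' ⊗ U → P ⊗ U` is what lets `z` come from `K' ⊗ U'`.
  have hz' : g.lTensor K' z = 0 := by
    apply hU
    rw [map_zero, ← comm, hz]
    exact (lTensor_exact P hfg hg).apply_apply_eq_zero y
  obtain ⟨t, rfl⟩ := (lTensor_exact K' hfg hg z).1 hz'
  have : a.rTensor U' t = y :=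
    Module.Flat.lTensor_preserves_injective_linearMap f hf (by rw [comm, hz])
  rw [← this]
  exact (rTensor_exact U' hab hb).apply_apply_eq_zero t

/-- In the commutative square from `K' ⊗ U'` to `P ⊗ F`, one path is injective, so the first map of
the other path is injective. This passes Tor-vanishing from `U` to its syzygy `U'`. -/
lemma rTensor_injective_of_lTensor_injective [Module.Flat R F] {a : K' →ₗ[R] P}
    (ha : Function.Injective a) {f : U' →ₗ[R] F} (h : Function.Injective (f.lTensor K')) :
    Function.Injective (a.rTensor U') := by
  have h' : Function.Injective ((a.rTensor F).comp (f.lTensor K')) :=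
    (Module.Flat.rTensor_preserves_injective_linearMap a ha).comp h
  rw [LinearMap.rTensor_comp_lTensor, ← LinearMap.lTensor_comp_rTensor] at h'
  exact Function.Injective.of_comp h'

end Dimension

end RelativeTate

namespace RelativeTate

/-! ### The `C`-injective modules form a self-orthogonal class. -/

section CInjective

open TensorProduct Abelian

variable {R : Type u} [CommRing R] {C : ModuleCat.{u} R}

lemma IsSemidualizing.exists_syzygies (hC : IsSemidualizing C) :
    ∃ K P : ℕ → ModuleCat.{u} R, K 0 = C ∧
      (∀ n, Module.Free R (P n) ∧ Module.Finite R (P n)) ∧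
      ∀ n, IsExtension (K (n + 1)) (P n) (K n) := by
  obtain ⟨P, π, w, hP, hac⟩ := hC.exists_resolution
  let Q := P.augment π w
  have hQ (n : ℕ) : IsExtension (Q.cycles (n + 1)) (P.X n) (Q.cycles n) :=
    .of_shortExact (shortExact_cycles (K := Q) (j := n + 1) (k := n) rfl (hac n))
  -- The augmentation places `C` in degree `0`, where the outgoing differential is zero; hence the
  -- indices of the syzygies and of `P` differ by one from those of `Q`.
  have e : Q.cycles 0 ≅ Q.X 0 := asIso (Q.iCycles 0)
  refine ⟨fun n => Nat.casesOn n C fun n => Q.cycles (n + 1), P.X, rfl, hP, fun n => ?_⟩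
  cases n with
  | zero => exact (hQ 0).of_iso (Iso.refl _) e
  | succ n => exact hQ (n + 1)

/-- The injectivity hypothesis says that `Torᵢ(K 0, U) = 0` for `i ≥ 1`, and `Extⁱ(U, Hom(K 0, J)) ≅
Hom(Torᵢ(K 0, U), J)`. Concretely, the hypothesis passes to a syzygy of `U`, and in degree one a map
to `Hom(K 0, J)` is extended through its adjoint by injectivity of `J`. -/
lemma subsingleton_ext_hom_of_rTensor_injective {K P : ℕ → ModuleCat.{u} R}
    [∀ n, Module.Flat R (P n)] {a : ∀ n, K (n + 1) →ₗ[R] P n} {b : ∀ n, P n →ₗ[R] K n}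
    (ha : ∀ n, Function.Injective (a n)) (hab : ∀ n, Function.Exact (a n) (b n))
    (hb : ∀ n, Function.Surjective (b n)) (J : ModuleCat.{u} R) [Module.Injective R J] (i : ℕ) :
    ∀ U : ModuleCat.{u} R, (∀ n, Function.Injective ((a n).rTensor U)) →
      Subsingleton (Ext.{u} U (ModuleCat.of R (K 0 →ₗ[R] J)) (i + 1)) := by
  have key (U : ModuleCat.{u} R) (hU : ∀ n, Function.Injective ((a n).rTensor U)) :
      ∃ S : ShortComplex (ModuleCat.{u} R), S.ShortExact ∧ S.X₃ = U ∧ Projective S.X₂ ∧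
        (∀ n, Function.Injective ((a n).rTensor S.X₁)) ∧
        Function.Injective (S.f.hom.lTensor (K 0)) := by
    obtain ⟨f, g, w, hS⟩ := isExtension_kernel (Projective.π U)
    have : Module.Projective R ↑(Projective.over U : ModuleCat.{u} R) :=
      (IsProjective.iff_projective (R := R) _).2
        (inferInstanceAs (Projective (Projective.over U)))
    have hK (n : ℕ) : Function.Injective (f.hom.lTensor (K n)) :=
      lTensor_injective_of_rTensor_injective (hab n) (hb n) hS.moduleCat_injective_f
        ((ShortComplex.ShortExact.moduleCat_exact_iff_function_exact _).1 hS.exact)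
        hS.moduleCat_surjective_g (hU n)
    exact ⟨_, hS, rfl, inferInstanceAs (Projective (Projective.over U)),
      fun n => rTensor_injective_of_lTensor_injective (ha n) (hK (n + 1)), hK 0⟩
  induction i with
  | zero =>
    intro U hU
    obtain ⟨S, hS, rfl, _, -, h⟩ := key U hU
    have := Ext.subsingleton_of_projective S.X₂ (ModuleCat.of R (K 0 →ₗ[R] J)) 0
    refine subsingleton_ext_one_of_exists_extension hS fun φ => ?_
    obtain ⟨ψ, hψ⟩ := Module.Injective.out (S.f.hom.lTensor (K 0)) h
      (TensorProduct.lift φ.hom.flip)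
    refine ⟨ModuleCat.ofHom (TensorProduct.curry ψ).flip, ?_⟩
    ext x k
    exact hψ (k ⊗ₜ x)
  | succ i ih =>
    intro U hU
    obtain ⟨S, hS, rfl, _, h, -⟩ := key U hU
    have := ih _ h
    have := Ext.subsingleton_of_projective S.X₂ (ModuleCat.of R (K 0 →ₗ[R] J)) (i + 1)
    exact subsingleton_ext_X₃_left hS _ (Nat.add_comm 1 (i + 1))

/-- `Extⁱ(C, C) = 0` passes to `Extⁱ(K n, C) = 0` for all syzygies; in degree one this extends maps
`K (n + 1) → C` to `P n`. -/
lemma IsSemidualizing.exists_syzygy_maps (hC : IsSemidualizing C) :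
    ∃ (K P : ℕ → ModuleCat.{u} R) (a : ∀ n, K (n + 1) →ₗ[R] P n) (b : ∀ n, P n →ₗ[R] K n),
      K 0 = C ∧ (∀ n, Module.Free R (P n) ∧ Module.Finite R (P n)) ∧
      (∀ n, Function.Injective (a n)) ∧ (∀ n, Function.Exact (a n) (b n)) ∧
      (∀ n, Function.Surjective (b n)) ∧
      ∀ n (f : K (n + 1) →ₗ[R] C), ∃ g : P n →ₗ[R] C, g.comp (a n) = f := by
  obtain ⟨K, P, hK, hP, h⟩ := hC.exists_syzygies
  have hperp (n : ℕ) : leftPerp.{u} (fun X => X = C) (K n) := by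
    induction n with
    | zero =>
      rintro X rfl i
      rw [hK]
      exact hC.ext_eq_zero _ (Nat.le_add_left 1 i)
    | succ n ih =>
      refine leftPerp.of_left (h n) (fun X _ i => ?_) ih
      have := (hP n).1
      have : Projective (P n) := (IsProjective.iff_projective (R := R) _).1 inferInstance
      exact Ext.subsingleton_of_projective _ _ _
  choose a b w hS using h
  refine ⟨K, P, fun n => (a n).hom, fun n => (b n).hom, hK, hP,
    fun n => (hS n).moduleCat_injective_f,
    fun n => (ShortComplex.ShortExact.moduleCat_exact_iff_function_exact _).1 (hS n).exact,
    fun n => (hS n).moduleCat_surjective_g, fun n f => ?_⟩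
  obtain ⟨g, hg⟩ := leftPerp.extendsAlong (hS n) (hperp n) C rfl (ModuleCat.ofHom f)
  exact ⟨g.hom, by simpa using congrArg ModuleCat.Hom.hom hg⟩

lemma IsSemidualizing.tensorEval_bijective (hC : IsSemidualizing C) (I : Type u) [AddCommGroup I]
    [Module R I] [Module.Injective R I] : Function.Bijective (tensorEval (R := R) C I C) := by
  obtain ⟨K, P, a, b, rfl, hP, ha, hab, hb, -⟩ := hC.exists_syzygy_maps
  have := fun n => (hP n).1
  have := fun n => (hP n).2
  refine tensorEval_bijective_of_exact (K 0) _ _ _ (a := (a 0).comp (b 1)) (b := b 0) ?_ (hb 0)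
    (tensorEval_bijective_of_free _ _ _).2 (tensorEval_bijective_of_free _ _ _)
  exact (Function.Surjective.comp_exact_iff_exact (hb 1)).2 (hab 0)

/-- All syzygies of `C` are finitely presented, so evaluation is bijective on them; since maps from
syzygies to `C` extend, the syzygy inclusions stay injective after tensoring with `Hom(C, I)`. -/
lemma IsSemidualizing.subsingleton_ext (hC : IsSemidualizing C) (I J : ModuleCat.{u} R)
    [Module.Injective R I] [Module.Injective R J] (i : ℕ) :
    Subsingleton (Ext.{u} (ModuleCat.of R (C →ₗ[R] I)) (ModuleCat.of R (C →ₗ[R] J)) (i + 1)) := by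
  obtain ⟨K, P, a, b, hK, hP, ha, hab, hb, hext⟩ := hC.exists_syzygy_maps
  have := fun n => (hP n).1
  have := fun n => (hP n).2
  have hbij (n : ℕ) : Function.Bijective (tensorEval (R := R) C I (K n)) := by
    refine tensorEval_bijective_of_exact C _ _ _ (a := (a n).comp (b (n + 1))) (b := b n) ?_ (hb n)
      (tensorEval_bijective_of_free _ _ _).2 (tensorEval_bijective_of_free _ _ _)
    exact (Function.Surjective.comp_exact_iff_exact (hb (n + 1))).2 (hab n)
  have h := subsingleton_ext_hom_of_rTensor_injective ha hab hb J i (ModuleCat.of R (C →ₗ[R] I))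
    fun n => rTensor_injective_of_tensorEval (hext n) (hbij (n + 1)).1
  rwa [hK] at h

section Retract

variable (I : Type u) [AddCommGroup I] [Module R I]

/-- Since `C ⊗ Hom(C, I) ≅ I`, the module `C ⊗ Z` is a retract of `I`, and `Z → Hom(C, C ⊗ Z)` is a
retract of the corresponding isomorphism for `Hom(C, I)`. -/
lemma IsSemidualizing.exists_hom_of_retract (hC : IsSemidualizing C) [Module.Injective R I]
    {Z : Type u} [AddCommGroup Z] [Module R Z] (i : Z →ₗ[R] (C →ₗ[R] I))
    (p : (C →ₗ[R] I) →ₗ[R] Z) (h : p.comp i = LinearMap.id) :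
    Module.Injective R (C ⊗[R] Z) ∧
      Function.Bijective (TensorProduct.mk R C Z).flip := by
  let e : R ≃ₗ[R] (C →ₗ[R] C) := LinearEquiv.ofBijective _ hC.homothety_bijective
  have he : e 1 = LinearMap.id := by ext; simp [e]
  let ev : ((C →ₗ[R] C) →ₗ[R] I) →ₗ[R] I := LinearMap.applyₗ LinearMap.id
  have hev : Function.Bijective ev := by
    constructor
    · rw [injective_iff_map_eq_zero]
      intro φ hφ
      ext f
      obtain ⟨r, rfl⟩ := e.surjective f
      have hr : e r = r • LinearMap.id := by rw [← he, ← map_smul, smul_eq_mul, mul_one]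
      rw [hr, map_smul, show φ LinearMap.id = 0 from hφ, smul_zero, LinearMap.zero_apply]
    · intro x
      refine ⟨(LinearMap.toSpanSingleton R I x).comp e.symm.toLinearMap, ?_⟩
      simp [ev, ← he]
  let ε : C ⊗[R] (C →ₗ[R] I) ≃ₗ[R] I := LinearEquiv.ofBijective (ev.comp (tensorEval C I C))
    (hev.comp (hC.tensorEval_bijective I))
  have hε (c : C) (f : C →ₗ[R] I) : ε (c ⊗ₜ f) = f c := rfl
  have h' : (p.lTensor C).comp (i.lTensor C) = LinearMap.id := by
    rw [← LinearMap.lTensor_comp, h, LinearMap.lTensor_id]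
  refine ⟨?_, fun z z' hz => ?_, fun φ => ?_⟩
  · have : Injective (ModuleCat.of R I) := Module.injective_object_of_injective_module R I
    have : Injective (ModuleCat.of R (C ⊗[R] Z)) :=
      Retract.injective (Y := ModuleCat.of R I)
        { i := ModuleCat.ofHom (ε.toLinearMap.comp (i.lTensor C))
          r := ModuleCat.ofHom ((p.lTensor C).comp ε.symm.toLinearMap)
          retract := by
            refine ModuleCat.hom_ext (LinearMap.ext fun x => ?_)
            simpa using LinearMap.congr_fun h' x }
    exact Module.injective_module_of_injective_object R _
  · have hi : Function.Injective i := Function.LeftInverse.injective (LinearMap.congr_fun h)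
    refine hi (LinearMap.ext fun c => ?_)
    have := congrArg (ε ∘ i.lTensor C) (LinearMap.congr_fun hz c)
    simpa [hε] using this
  -- The preimage of `φ` is found by passing to `Hom(C, I)` through `C ⊗ i` and `ε`, and coming back
  -- by `p`.
  · refine ⟨p (ε.toLinearMap.comp ((i.lTensor C).comp φ)), LinearMap.ext fun c => ?_⟩
    refine (LinearMap.lTensor_tmul C p c _).symm.trans ?_
    have : c ⊗ₜ[R] (ε.toLinearMap.comp ((i.lTensor C).comp φ)) = i.lTensor C (φ c) :=
      ε.injective (hε _ _)
    rw [this]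
    exact LinearMap.congr_fun h' (φ c)

end Retract

lemma IsSemidualizing.isSelfOrthogonal_cInjective (hC : IsSemidualizing C) :
    IsSelfOrthogonal.{u} (cInjective C) where
  zero X hX := by
    have : Subsingleton X := ModuleCat.subsingleton_of_isZero hX
    refine ⟨ModuleCat.of R PUnit, (IsZero.injective ?_),
      ⟨hX.iso (ModuleCat.isZero_of_subsingleton _)⟩⟩
    exact ModuleCat.isZero_of_subsingleton _
  biprod X Y := by
    rintro ⟨I, hI, ⟨e⟩⟩ ⟨J, hJ, ⟨e'⟩⟩
    refine ⟨ModuleCat.of R (I × J), Injective.of_iso (ModuleCat.biprodIsoProd I J) inferInstance,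
      ⟨biprod.mapIso e e' ≪≫ ModuleCat.biprodIsoProd _ _ ≪≫
        (LinearMap.prodEquiv R).toModuleIso⟩⟩
  retract {X Y} i p h := by
    rintro ⟨I, hI, ⟨e⟩⟩
    have := Module.injective_module_of_injective_object R I
    obtain ⟨h₁, h₂⟩ := hC.exists_hom_of_retract I (i ≫ e.hom).hom (e.inv ≫ p).hom (by
      rw [← ModuleCat.hom_comp, Category.assoc, e.hom_inv_id_assoc, h, ModuleCat.hom_id])
    exact ⟨ModuleCat.of R (C ⊗[R] X), Module.injective_object_of_injective_module R _,
      ⟨(LinearEquiv.ofBijective _ h₂).toModuleIso⟩⟩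
  ext X Y := by
    rintro ⟨I, hI, ⟨e⟩⟩ ⟨J, hJ, ⟨e'⟩⟩ i
    have := Module.injective_module_of_injective_object R I
    have := Module.injective_module_of_injective_object R J
    have h : rightPerp.{u} (fun Z => Z = ModuleCat.of R (C →ₗ[R] I)) Y :=
      rightPerp.of_iso e'.symm fun Z hZ i => hZ ▸ hC.subsingleton_ext I J i
    have h' : leftPerp.{u} (fun Z => Z = Y) X :=
      leftPerp.of_iso e.symm fun Z hZ i => hZ ▸ h _ rfl i
    exact h' Y rfl i

end CInjective

end RelativeTate

theorem corollary5p5 {R : Type u} [CommRing R] (C : ModuleCat.{u} R)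
    (hC : RelativeTate.IsSemidualizing C) (M : ModuleCat.{u} R)
    (hM : RelativeTate.injDim (RelativeTate.gorenstein (RelativeTate.cInjective C)) M < ⊤) :
    ∃ hT : RelativeTate.HasTateCoresolution (RelativeTate.cInjective C) M,
      List.TFAE [
        RelativeTate.injDim (RelativeTate.cInjective C) M < ⊤,
        ∀ n : ℤ, ∀ (N : ModuleCat.{u} R)
          (hN : RelativeTate.HasTateCoresolution (RelativeTate.cInjective C) N),
          IsZero (RelativeTate.tateExt (RelativeTate.cInjective C) n M N hN),
        ∃ n : ℤ, ∀ (N : ModuleCat.{u} R)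
          (hN : RelativeTate.HasTateCoresolution (RelativeTate.cInjective C) N),
          IsZero (RelativeTate.tateExt (RelativeTate.cInjective C) n M N hN),
        ∀ n : ℤ, ∀ N : ModuleCat.{u} R,
          IsZero (RelativeTate.tateExt (RelativeTate.cInjective C) n N M hT),
        ∃ n : ℤ, ∀ N : ModuleCat.{u} R,
          IsZero (RelativeTate.tateExt (RelativeTate.cInjective C) n N M hT),
        IsZero (RelativeTate.tateExt (RelativeTate.cInjective C) 0 M M hT)] := by
  have := hC.isSelfOrthogonal_cInjective
  have hT := RelativeTate.hasTateCoresolution_of_injDim_gorenstein.{u} hM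
  exact ⟨hT, RelativeTate.tfae_injDim_lt_top.{u} hT⟩
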